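/- Let $m$ be the normalized Lebesgue measure on the unit circle $\mathbb T$. A probability Borel measure $\sigma$ on $\mathbb T$, with an arbitrary singular part, is called a Szegő measure if $\int_{\mathbb T}\log\sigma'\,dm>-\infty$, where $\sigma'$ is the density of the absolutely continuous part of $\sigma$ with respect to $m$. For such $\sigma$ let $\varphi_n=\varphi_n(\sigma)$, $n\ge 0$, be the orthonormal polynomials of $\sigma$ (so $\deg\varphi_n=n$, the leading coefficient is positive, and $\int_{\mathbb T}\varphi_n\overline{\varphi_k}\,d\sigma=\delta_{nk}$), and let $$\varepsilon_n(\sigma)=\int_{\mathbb T}|\varphi_n|^2\log|\varphi_n|\,d\sigma .$$ Then $\varepsilon_n(\sigma)=o(\sqrt n)$ as $n\to\infty$ for every Szegő measure $\sigma$, and this bound is sharp: for every sequence $h:\mathbb N\to\mathbb R$ with $\lim_{n\to\infty}h(n)=0$ there are a Szegő measure $\sigma$ and integers $0\le M_1<M_2<\cdots$ such that $$\varepsilon_{M_k}(\sigma)\ \ge\ h(M_k)\sqrt{M_k}\qquad\text{for all }k .$$ -/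

import Mathlib

open MeasureTheory Filter Topology Asymptotics Polynomial

namespace OPUC

noncomputable section

/-- The Borel σ-algebra on the unit circle. -/
instance circleMeasurableSpace : MeasurableSpace Circle := borel Circle

instance circleBorelSpace : BorelSpace Circle := ⟨rfl⟩

/-- The normalized Lebesgue measure `dm = dθ / (2π)` on the unit circle: the image of
`(2π)⁻¹ dθ` on `(-π, π]` under `θ ↦ e^{iθ}`. -/
def circleLebesgue : Measure Circle :=
  ENNReal.ofReal (2 * Real.pi)⁻¹ •
    Measure.map Circle.exp (volume.restrict (Set.Ioc (-Real.pi) Real.pi))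

/-- The Szegő condition `∫ log σ' dm > -∞`, where `σ'` is the density of the absolutely continuous
part of `σ` (the Radon–Nikodym derivative); nothing is asked of the singular part. For a finite
measure, `log⁺ σ' ≤ σ'` is integrable, so that the integral is always defined in `[-∞, ∞)` and it
is greater than `-∞` iff `σ' > 0` almost everywhere (`Real.log 0 = 0` is excluded this way) and
`log σ'` is integrable. -/
def IsSzego (σ : Measure Circle) : Prop :=
  (∀ᵐ z ∂circleLebesgue, 0 < σ.rnDeriv circleLebesgue z) ∧
    Integrable (fun z => Real.log (σ.rnDeriv circleLebesgue z).toReal) circleLebesgue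

/-- The inner product `⟨p, q⟩ = ∫ conj (p z) * q z dσ` of polynomials in `L²(σ)`. -/
def polyInner (σ : Measure Circle) (p q : ℂ[X]) : ℂ :=
  ∫ z : Circle, (starRingEnd ℂ) (p.eval (z : ℂ)) * q.eval (z : ℂ) ∂σ

/-- The monic orthogonal polynomials `Φ_n` of `σ`: Gram–Schmidt orthogonalization of
`1, z, z², …` in `L²(σ)`. -/
def monicPoly (σ : Measure Circle) (n : ℕ) : ℂ[X] :=
  X ^ n - ∑ k : Fin n,
    C (polyInner σ (monicPoly σ k) (X ^ n) /
      polyInner σ (monicPoly σ k) (monicPoly σ k)) * monicPoly σ k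
termination_by n
decreasing_by all_goals exact k.isLt

/-- The `L²(σ)` norm of a polynomial. -/
def polyNorm (σ : Measure Circle) (p : ℂ[X]) : ℝ :=
  √(∫ z : Circle, ‖p.eval (z : ℂ)‖ ^ 2 ∂σ)

/-- The orthonormal polynomials `φ_n = Φ_n / ‖Φ_n‖` of `σ`, with positive leading coefficient. -/
def orthoPoly (σ : Measure Circle) (n : ℕ) : ℂ[X] :=
  C (((polyNorm σ (monicPoly σ n))⁻¹ : ℝ) : ℂ) * monicPoly σ n

/-- The entropy integral `ε_n(σ) = ∫ |φ_n|² log |φ_n| dσ`. The integrand is a continuous function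
on the circle, as `x ^ 2 * log x` is continuous and vanishes at `x = 0`. -/
def entropyIntegral (σ : Measure Circle) (n : ℕ) : ℝ :=
  ∫ z : Circle, ‖(orthoPoly σ n).eval (z : ℂ)‖ ^ 2 *
    Real.log ‖(orthoPoly σ n).eval (z : ℂ)‖ ∂σ

end

end OPUC

namespace OPUC

/-! Upper bound. Let Φ_n be the monic orthogonal polynomials. Szegő's recurrence zΦ_n - Φ_{n+1} =
e_n Φ_n^* comes with |e_n|²‖Φ_n‖² = ‖Φ_n‖² - ‖Φ_{n+1}‖². Jensen's inequality and the Szegő condition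
bound ‖Φ_n‖ away from 0, so the e_n are square summable. On the circle |Φ_n^*| = |Φ_n|, whence sup
|Φ_n| ≤ exp(∑_{k<n} |e_k|), and Cauchy–Schwarz on tails makes the exponent o(√n). Since ∫|φ_n|² dσ =
1, ε_n is at most sup log |φ_n|; the integrand is bounded below, so ε_n is bounded below as well.

Sharpness. A Baire category argument in the space of pairs (w, log w) in L¹ × L¹, which is complete.
For each N, the weights with ε_n > h(n)√n for some n ≥ N form an open set, because ε_n is weakly
continuous in the measure. Everything rests on density (`exists_perturbation`), where a bounded
weight e^u is perturbed in two stages.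

First, multiply it by a Bernstein–Szegő weight 1/|Q|² of degree N with negative Verblunsky
coefficients of size about ε/√N, plus a harmonic-type correction near index N
(`exists_bernsteinSzego`). The squares of the coefficients have a small sum, so the factor and its
logarithm are L¹-close to 1 and 0. Yet |Q(1)|² ≥ exp(ε√N), and the Christoffel–Darboux kernel
K_{N+1} at 1 is comparable to |Q(1)|². Multiplying Q by geometric sums shows that K at least doubles
within L further degrees, L independent of N; hence K_{n+1} ≥ (1+c)K_n for some n in this window, c
depending on L only.

Second, add the mass 1/K_{n+1} at 1. It is exponentially small, but the new φ_n keeps a fixed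
fraction of its L² norm on it, while log |φ_n(1)| is of order √N
(`Nondegenerate.entropyIntegral_add_dirac_ge`). So ε_n is at least a fixed multiple of √N, and h → 0
wins. Weak continuity then allows the atom to be replaced by a narrow bump that hardly changes log w
(`exists_smeared_point_mass`). -/

/-! ### Integration over the unit circle -/

theorem periodic_circleMap_comp {E : Type*} (f : ℂ → E) :
    Function.Periodic (fun θ : ℝ => f (circleMap 0 1 θ)) (2 * Real.pi) := fun θ => by
  simp only [periodic_circleMap 0 1 θ]

theorem coe_exp_eq_circleMap (θ : ℝ) : ((Circle.exp θ : Circle) : ℂ) = circleMap 0 1 θ := by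
  simp [circleMap, Circle.coe_exp]

/-- The integral against normalized Lebesgue measure is Mathlib's circle average. -/
theorem integral_circleLebesgue {E : Type*} [NormedAddCommGroup E] [NormedSpace ℝ E]
    {f : ℂ → E} (hf : StronglyMeasurable fun z : Circle => f z) :
    ∫ z : Circle, f z ∂circleLebesgue = Real.circleAverage f 0 1 := by
  have hp : (0 : ℝ) ≤ (2 * Real.pi)⁻¹ := by positivity
  rw [circleLebesgue, integral_smul_measure, ENNReal.toReal_ofReal hp,
    integral_map Circle.exp.continuous.aemeasurable hf.aestronglyMeasurable,
    Real.circleAverage_def]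
  congr 1
  have h := (periodic_circleMap_comp f).intervalIntegral_add_eq (-Real.pi) 0
  rw [show -Real.pi + 2 * Real.pi = Real.pi by ring, zero_add] at h
  rw [← h, intervalIntegral.integral_of_le (by linarith [Real.pi_pos])]
  simp only [coe_exp_eq_circleMap]

theorem integrable_circleLebesgue {E : Type*} [NormedAddCommGroup E]
    {f : ℂ → E} (hf : StronglyMeasurable fun z : Circle => f z)
    (hi : CircleIntegrable f 0 1) :
    Integrable (fun z : Circle => f z) circleLebesgue := by
  unfold circleLebesgue
  refine Integrable.smul_measure ?_ ENNReal.ofReal_ne_top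
  rw [integrable_map_measure hf.aestronglyMeasurable Circle.exp.continuous.aemeasurable]
  have h : IntervalIntegrable (fun θ : ℝ => f (circleMap 0 1 θ)) volume
      (-Real.pi) Real.pi := by
    have := (periodic_circleMap_comp f).intervalIntegrable (by positivity) (t := 0)
      (by simpa [CircleIntegrable] using hi) (-Real.pi) Real.pi
    exact this
  rw [intervalIntegrable_iff_integrableOn_Ioc_of_le (by linarith [Real.pi_pos])] at h
  simpa only [IntegrableOn, Function.comp_def, coe_exp_eq_circleMap] using h

instance isProbabilityMeasure_circleLebesgue : IsProbabilityMeasure circleLebesgue := by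
  constructor
  rw [circleLebesgue, Measure.smul_apply, Measure.map_apply Circle.exp.continuous.measurable
    MeasurableSet.univ, Set.preimage_univ, Measure.restrict_apply_univ, Real.volume_Ioc,
    smul_eq_mul, ← ENNReal.ofReal_mul (by positivity)]
  rw [show (2 * Real.pi)⁻¹ * (Real.pi - -Real.pi) = 1 by
    field_simp; ring]
  simp

instance nullSingleton_circleLebesgue : NullSingletonClass circleLebesgue := by
  constructor
  intro z
  rw [circleLebesgue, Measure.smul_apply, Measure.map_apply Circle.exp.continuous.measurable
    (measurableSet_singleton z), Measure.restrict_apply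
      (Circle.exp.continuous.measurable (measurableSet_singleton z))]
  have : (Circle.exp ⁻¹' {z} ∩ Set.Ioc (-Real.pi) Real.pi).Subsingleton := by
    rintro x ⟨hx, hx'⟩ y ⟨hy, hy'⟩
    rw [← Circle.arg_exp hx'.1 hx'.2, ← Circle.arg_exp hy'.1 hy'.2]
    simp only [Set.mem_preimage, Set.mem_singleton_iff] at hx hy
    rw [hx, hy]
  rw [this.measure_zero]
  simp

theorem circleLebesgue_ball_pos {r : ℝ} (hr : 0 < r) :
    0 < circleLebesgue (Metric.ball (1 : Circle) r) := by
  have ho : IsOpen (Circle.exp ⁻¹' Metric.ball (1 : Circle) r ∩ Set.Ioo (-Real.pi) Real.pi) :=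
    (Metric.isOpen_ball.preimage Circle.exp.continuous).inter isOpen_Ioo
  have h0 : (0 : ℝ) ∈ Circle.exp ⁻¹' Metric.ball (1 : Circle) r ∩ Set.Ioo (-Real.pi) Real.pi := by
    refine ⟨?_, by linarith [Real.pi_pos], Real.pi_pos⟩
    simpa [Circle.exp_zero] using hr
  have hpos := ho.measure_pos volume ⟨0, h0⟩
  rw [circleLebesgue, Measure.smul_apply, Measure.map_apply Circle.exp.continuous.measurable
    Metric.isOpen_ball.measurableSet, Measure.restrict_apply
      (Circle.exp.continuous.measurable Metric.isOpen_ball.measurableSet), smul_eq_mul]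
  refine ENNReal.mul_pos (by simp [Real.pi_pos]) (ne_of_gt (hpos.trans_le ?_))
  exact measure_mono (Set.inter_subset_inter_right _ Set.Ioo_subset_Ioc_self)

theorem continuous_integrable {E : Type*} [NormedAddCommGroup E] {f : Circle → E}
    (hf : Continuous f) (σ : Measure Circle) [IsFiniteMeasure σ] : Integrable f σ :=
  hf.integrable_of_hasCompactSupport (HasCompactSupport.of_compactSpace f)

/-- Mean value property at the origin over the unit circle. -/
theorem integral_circleLebesgue_eq_zero_value {f : ℂ → ℂ}
    (hf : ∀ z ∈ Metric.closedBall (0 : ℂ) 1, DifferentiableAt ℂ f z) :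
    ∫ z : Circle, f z ∂circleLebesgue = f 0 := by
  have hc : Continuous fun z : Circle => f z := by
    rw [continuous_iff_continuousAt]
    intro z
    exact ContinuousAt.comp (f := fun z : Circle => (z : ℂ))
      ((hf z (by simp [Circle.norm_coe z])).continuousAt) (by fun_prop)
  rw [integral_circleLebesgue hc.stronglyMeasurable]
  apply DiffContOnCl.circleAverage
  apply DifferentiableOn.diffContOnCl
  rw [abs_one, closure_ball _ one_ne_zero]
  exact fun z hz => (hf z hz).differentiableWithinAt

theorem continuous_eval_circle (P : ℂ[X]) : Continuous fun z : Circle => P.eval (z : ℂ) :=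
  P.continuous.comp continuous_subtype_val

theorem continuous_inner_circle (P Q : ℂ[X]) :
    Continuous fun z : Circle => (starRingEnd ℂ) (P.eval (z : ℂ)) * Q.eval (z : ℂ) :=
  (Complex.continuous_conj.comp (continuous_eval_circle P)).mul (continuous_eval_circle Q)

/-! ### Polynomials in L²(σ) and Gram–Schmidt orthogonalization -/

/-- The squared `L²(σ)` norm of a polynomial. -/
noncomputable def energy (σ : Measure Circle) (P : ℂ[X]) : ℝ :=
  ∫ z : Circle, ‖P.eval (z : ℂ)‖ ^ 2 ∂σ

theorem continuous_normSq_circle (P : ℂ[X]) :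
    Continuous fun z : Circle => ‖P.eval (z : ℂ)‖ ^ 2 :=
  (continuous_eval_circle P).norm.pow 2

theorem energy_nonneg (σ : Measure Circle) (P : ℂ[X]) : 0 ≤ energy σ P :=
  integral_nonneg fun _ => by positivity

/-- The measures for which nonzero polynomials have positive `L²(σ)` norm. -/
def Nondegenerate (σ : Measure Circle) : Prop := ∀ P : ℂ[X], P ≠ 0 → 0 < energy σ P

section Inner

variable (σ : Measure Circle)

theorem polyInner_self (P : ℂ[X]) : polyInner σ P P = (energy σ P : ℂ) := by
  rw [polyInner, energy, ← integral_complex_ofReal]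
  congr 1
  ext z
  rw [Complex.conj_mul']
  push_cast
  rfl

theorem polyInner_conj (P Q : ℂ[X]) :
    (starRingEnd ℂ) (polyInner σ P Q) = polyInner σ Q P := by
  rw [polyInner, polyInner, ← integral_conj]
  congr 1
  ext z
  simp [mul_comm]

theorem polyInner_eq_zero_symm {P Q : ℂ[X]} (h : polyInner σ P Q = 0) :
    polyInner σ Q P = 0 := by
  rw [← polyInner_conj, h, map_zero]

theorem polyInner_C_mul_right (P Q : ℂ[X]) (c : ℂ) :
    polyInner σ P (C c * Q) = c * polyInner σ P Q := by
  rw [polyInner, polyInner, ← integral_const_mul]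
  congr 1
  ext z
  simp only [eval_mul, eval_C]
  ring

theorem polyInner_C_mul_left (P Q : ℂ[X]) (c : ℂ) :
    polyInner σ (C c * P) Q = (starRingEnd ℂ) c * polyInner σ P Q := by
  rw [← polyInner_conj, polyInner_C_mul_right, map_mul, polyInner_conj]

theorem polyInner_zero_right (P : ℂ[X]) : polyInner σ P 0 = 0 := by
  simp [polyInner]

/-- Multiplication by z is isometric because |z| = 1 on the circle; this is the only feature of the
circle, besides reversal, behind the Szegő recurrence. -/
theorem polyInner_X_mul (P Q : ℂ[X]) : polyInner σ (X * P) (X * Q) = polyInner σ P Q := by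
  rw [polyInner, polyInner]
  congr 1
  ext z
  have hz : (starRingEnd ℂ) (z : ℂ) * (z : ℂ) = 1 := by
    rw [Complex.conj_mul']
    simp [Circle.norm_coe z]
  simp only [eval_mul, eval_X, map_mul]
  linear_combination (starRingEnd ℂ) (P.eval (z : ℂ)) * Q.eval (z : ℂ) * hz

variable [IsFiniteMeasure σ]

theorem polyInner_add_right (P Q R : ℂ[X]) :
    polyInner σ P (Q + R) = polyInner σ P Q + polyInner σ P R := by
  rw [polyInner, polyInner, polyInner,
    ← integral_add (continuous_integrable (continuous_inner_circle P Q) σ)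
      (continuous_integrable (continuous_inner_circle P R) σ)]
  congr 1
  ext z
  simp only [eval_add]
  ring

theorem polyInner_sub_right (P Q R : ℂ[X]) :
    polyInner σ P (Q - R) = polyInner σ P Q - polyInner σ P R := by
  have h := polyInner_add_right σ P (Q - R) R
  rw [sub_add_cancel] at h
  rw [h, add_sub_cancel_right]

theorem polyInner_sum_right {ι : Type*} (s : Finset ι) (P : ℂ[X]) (Q : ι → ℂ[X]) :
    polyInner σ P (∑ i ∈ s, Q i) = ∑ i ∈ s, polyInner σ P (Q i) := by
  classical
  induction s using Finset.induction_on with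
  | empty => simp [polyInner_zero_right]
  | insert a s ha ih => rw [Finset.sum_insert ha, Finset.sum_insert ha, polyInner_add_right, ih]

theorem polyInner_sum_left {ι : Type*} (s : Finset ι) (P : ι → ℂ[X]) (Q : ℂ[X]) :
    polyInner σ (∑ i ∈ s, P i) Q = ∑ i ∈ s, polyInner σ (P i) Q := by
  rw [← polyInner_conj, polyInner_sum_right, map_sum]
  exact Finset.sum_congr rfl fun i _ => polyInner_conj σ _ _

theorem energy_add_of_orthogonal {P Q : ℂ[X]} (h : polyInner σ P Q = 0) :
    energy σ (P + Q) = energy σ P + energy σ Q := by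
  have h1 : polyInner σ (P + Q) (P + Q) = polyInner σ P P + polyInner σ Q Q := by
    have e1 : ∀ R, polyInner σ (P + Q) R = polyInner σ P R + polyInner σ Q R := fun R => by
      rw [← polyInner_conj, polyInner_add_right, map_add, polyInner_conj, polyInner_conj]
    rw [e1, polyInner_add_right, polyInner_add_right, h, polyInner_eq_zero_symm σ h]
    ring
  simp only [polyInner_self] at h1
  exact_mod_cast h1

end Inner

theorem energy_C_mul (σ : Measure Circle) (c : ℂ) (P : ℂ[X]) :
    energy σ (C c * P) = ‖c‖ ^ 2 * energy σ P := by
  rw [energy, energy, ← integral_const_mul]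
  congr 1
  ext z
  rw [eval_mul, eval_C, norm_mul, mul_pow]

theorem degree_C_mul_le_self (a : ℂ) (P : ℂ[X]) : (C a * P).degree ≤ P.degree := by
  rw [← smul_eq_C_mul]
  exact degree_smul_le a P

theorem degree_sum_lt {ι : Type*} {s : Finset ι} {n : ℕ} {p : ι → ℂ[X]}
    (h : ∀ i ∈ s, (p i).degree < n) : (∑ i ∈ s, p i).degree < n := by
  rw [← mem_degreeLT]
  exact Submodule.sum_mem _ fun i hi => mem_degreeLT.2 (h i hi)

/-- Every polynomial of degree less than `n` is a combination of polynomials of degrees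
`0, …, n - 1`. -/
theorem exists_expansion {p : ℕ → ℂ[X]} (hp : ∀ k, (p k).degree = k) (n : ℕ) (P : ℂ[X])
    (hP : P.degree < n) : ∃ c : ℕ → ℂ, P = ∑ k ∈ Finset.range n, C (c k) * p k := by
  induction n generalizing P with
  | zero =>
    refine ⟨0, ?_⟩
    simpa using hP
  | succ n ih =>
    have hn : (p n).coeff n ≠ 0 := by
      have h := hp n
      have h2 := natDegree_eq_of_degree_eq_some h
      have h3 : (p n).leadingCoeff ≠ 0 := leadingCoeff_ne_zero.2 (fun h' => by simp [h'] at h)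
      rwa [leadingCoeff, h2] at h3
    set a := P.coeff n / (p n).coeff n with ha
    have hlow : (P - C a * p n).degree < n := by
      rw [degree_lt_iff_coeff_zero]
      intro m hm
      rcases hm.eq_or_lt with rfl | hm
      · rw [coeff_sub, coeff_C_mul, ha, div_mul_cancel₀ _ hn, sub_self]
      · rw [coeff_sub, coeff_C_mul, coeff_eq_zero_of_degree_lt, coeff_eq_zero_of_degree_lt]
        · simp
        · rw [hp]; exact_mod_cast hm
        · exact hP.trans_le (by exact_mod_cast hm)
    obtain ⟨c, hc⟩ := ih _ hlow
    refine ⟨fun k => if k < n then c k else a, ?_⟩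
    simp only [Finset.sum_range_succ, lt_irrefl, if_false]
    have : ∑ k ∈ Finset.range n, C (if k < n then c k else a) * p k
        = ∑ k ∈ Finset.range n, C (c k) * p k :=
      Finset.sum_congr rfl fun k hk => by rw [if_pos (Finset.mem_range.1 hk)]
    rw [this, ← hc]
    ring

theorem monicPoly_eq (σ : Measure Circle) (n : ℕ) :
    monicPoly σ n = X ^ n - ∑ k ∈ Finset.range n,
      C (polyInner σ (monicPoly σ k) (X ^ n) /
        polyInner σ (monicPoly σ k) (monicPoly σ k)) * monicPoly σ k := by
  rw [monicPoly]
  congr 1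
  exact Fin.sum_univ_eq_sum_range (fun k => C (polyInner σ (monicPoly σ k) (X ^ n) /
        polyInner σ (monicPoly σ k) (monicPoly σ k)) * monicPoly σ k) n

theorem degree_monicPoly_sub_lt (σ : Measure Circle) (n : ℕ) :
    (monicPoly σ n).degree = (n : WithBot ℕ) ∧
      (monicPoly σ n - X ^ n).degree < (n : WithBot ℕ) := by
  induction n using Nat.strong_induction_on with
  | _ n ih =>
    have h2 : (monicPoly σ n - X ^ n).degree < (n : WithBot ℕ) := by
      rw [monicPoly_eq, sub_sub_cancel_left, degree_neg]
      refine degree_sum_lt fun k hk => ?_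
      refine (degree_C_mul_le_self _ _).trans_lt ?_
      rw [(ih k (Finset.mem_range.1 hk)).1]
      exact_mod_cast Finset.mem_range.1 hk
    refine ⟨?_, h2⟩
    have h3 := degree_add_eq_left_of_degree_lt (p := (X : ℂ[X]) ^ n)
      (q := monicPoly σ n - X ^ n) (by rwa [degree_X_pow])
    rwa [degree_X_pow, add_sub_cancel] at h3

theorem degree_monicPoly (σ : Measure Circle) (n : ℕ) : (monicPoly σ n).degree = n :=
  (degree_monicPoly_sub_lt σ n).1

theorem monic_monicPoly (σ : Measure Circle) (n : ℕ) : (monicPoly σ n).Monic := by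
  have h3 := monic_X_pow_add (degree_monicPoly_sub_lt σ n).2
  rwa [add_sub_cancel] at h3

theorem Nondegenerate.polyInner_self_ne_zero {σ : Measure Circle} (hσ : Nondegenerate σ)
    {P : ℂ[X]} (hP : P ≠ 0) : polyInner σ P P ≠ 0 := by
  rw [polyInner_self]
  exact_mod_cast (hσ P hP).ne'

theorem Nondegenerate.energy_monicPoly_pos {σ : Measure Circle} (hσ : Nondegenerate σ) (n : ℕ) :
    0 < energy σ (monicPoly σ n) := hσ _ (monic_monicPoly σ n).ne_zero

theorem Nondegenerate.polyInner_monicPoly_of_lt {σ : Measure Circle} [IsFiniteMeasure σ]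
    (hσ : Nondegenerate σ) {k n : ℕ} (hk : k < n) :
    polyInner σ (monicPoly σ k) (monicPoly σ n) = 0 := by
  induction n using Nat.strong_induction_on generalizing k with
  | _ n ih =>
    rw [monicPoly_eq σ n, polyInner_sub_right, polyInner_sum_right,
      Finset.sum_eq_single_of_mem k (Finset.mem_range.2 hk)]
    · rw [polyInner_C_mul_right, div_mul_cancel₀ _
        (hσ.polyInner_self_ne_zero (monic_monicPoly σ k).ne_zero), sub_self]
    · intro j hj hjk
      rw [polyInner_C_mul_right]
      rcases hjk.lt_or_gt with h | h
      · rw [polyInner_eq_zero_symm σ (ih k hk h), mul_zero]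
      · rw [ih j (Finset.mem_range.1 hj) h, mul_zero]

theorem Nondegenerate.polyInner_monicPoly_of_degree_lt {σ : Measure Circle} [IsFiniteMeasure σ]
    (hσ : Nondegenerate σ) {n : ℕ} {P : ℂ[X]} (hP : P.degree < n) :
    polyInner σ P (monicPoly σ n) = 0 := by
  obtain ⟨c, rfl⟩ := exists_expansion (degree_monicPoly σ) n P hP
  rw [polyInner_sum_left]
  refine Finset.sum_eq_zero fun k hk => ?_
  rw [polyInner_C_mul_left, hσ.polyInner_monicPoly_of_lt (Finset.mem_range.1 hk), mul_zero]

theorem polyNorm_eq (σ : Measure Circle) (P : ℂ[X]) : polyNorm σ P = √(energy σ P) := rfl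

theorem Nondegenerate.polyNorm_monicPoly_pos {σ : Measure Circle} (hσ : Nondegenerate σ) (n : ℕ) :
    0 < polyNorm σ (monicPoly σ n) :=
  Real.sqrt_pos.2 (hσ.energy_monicPoly_pos n)

theorem Nondegenerate.degree_orthoPoly {σ : Measure Circle} (hσ : Nondegenerate σ) (n : ℕ) :
    (orthoPoly σ n).degree = n := by
  rw [orthoPoly, degree_C_mul, degree_monicPoly]
  exact_mod_cast (inv_pos.2 (hσ.polyNorm_monicPoly_pos n)).ne'

theorem Nondegenerate.polyInner_orthoPoly {σ : Measure Circle} [IsFiniteMeasure σ]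
    (hσ : Nondegenerate σ) (j k : ℕ) :
    polyInner σ (orthoPoly σ j) (orthoPoly σ k) = if j = k then 1 else 0 := by
  rw [orthoPoly, orthoPoly, polyInner_C_mul_left, polyInner_C_mul_right]
  split_ifs with h
  · subst h
    have h0 := hσ.polyNorm_monicPoly_pos j
    have h1 : energy σ (monicPoly σ j) = polyNorm σ (monicPoly σ j) ^ 2 :=
      (Real.sq_sqrt (energy_nonneg _ _)).symm
    rw [polyInner_self, h1, Complex.conj_ofReal]
    norm_cast
    field_simp
  · rcases Ne.lt_or_gt h with h | h
    · rw [hσ.polyInner_monicPoly_of_lt h]; simp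
    · rw [polyInner_eq_zero_symm σ (hσ.polyInner_monicPoly_of_lt h)]; simp

theorem Nondegenerate.energy_orthoPoly {σ : Measure Circle} [IsFiniteMeasure σ]
    (hσ : Nondegenerate σ) (n : ℕ) : energy σ (orthoPoly σ n) = 1 := by
  have h := hσ.polyInner_orthoPoly n n
  rw [polyInner_self, if_pos rfl] at h
  exact_mod_cast h

/-- Parseval's identity for finite combinations of orthonormal polynomials. -/
theorem Nondegenerate.energy_sum {σ : Measure Circle} [IsFiniteMeasure σ]
    (hσ : Nondegenerate σ) (c : ℕ → ℂ) (n : ℕ) :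
    energy σ (∑ k ∈ Finset.range n, C (c k) * orthoPoly σ k)
      = ∑ k ∈ Finset.range n, ‖c k‖ ^ 2 := by
  induction n with
  | zero => simp [energy]
  | succ n ih =>
    rw [Finset.sum_range_succ, Finset.sum_range_succ, energy_add_of_orthogonal, ih,
      energy_C_mul, hσ.energy_orthoPoly, mul_one]
    rw [polyInner_sum_left]
    refine Finset.sum_eq_zero fun k hk => ?_
    rw [polyInner_C_mul_left, polyInner_C_mul_right, hσ.polyInner_orthoPoly,
      if_neg (Finset.mem_range.1 hk).ne]
    simp

/-! ### The Christoffel–Darboux kernel at 1 and the effect of a point mass -/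

/-- The Christoffel–Darboux kernel of degree `< n` on the diagonal at `1`. -/
noncomputable def kernelOne (σ : Measure Circle) (n : ℕ) : ℝ :=
  ∑ k ∈ Finset.range n, ‖(orthoPoly σ k).eval 1‖ ^ 2

theorem kernelOne_nonneg (σ : Measure Circle) (n : ℕ) : 0 ≤ kernelOne σ n :=
  Finset.sum_nonneg fun _ _ => by positivity

theorem kernelOne_mono (σ : Measure Circle) : Monotone (kernelOne σ) := fun _ _ h =>
  Finset.sum_le_sum_of_subset_of_nonneg (Finset.range_mono h) fun _ _ _ => by positivity

theorem kernelOne_succ (σ : Measure Circle) (n : ℕ) :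
    kernelOne σ (n + 1) = kernelOne σ n + ‖(orthoPoly σ n).eval 1‖ ^ 2 :=
  Finset.sum_range_succ _ _

/-- Extremal property of the Christoffel–Darboux kernel. -/
theorem Nondegenerate.norm_eval_one_sq_le {σ : Measure Circle} [IsFiniteMeasure σ]
    (hσ : Nondegenerate σ) {n : ℕ} {P : ℂ[X]} (hP : P.degree < n) :
    ‖P.eval 1‖ ^ 2 ≤ kernelOne σ n * energy σ P := by
  obtain ⟨c, rfl⟩ := exists_expansion hσ.degree_orthoPoly n P hP
  rw [hσ.energy_sum, eval_finsetSum, kernelOne, mul_comm]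
  refine le_trans ?_ (Finset.sum_mul_sq_le_sq_mul_sq _ _ _)
  gcongr
  refine (norm_sum_le _ _).trans (Finset.sum_le_sum fun k _ => ?_)
  rw [eval_mul, eval_C, norm_mul]

/-- The reproducing kernel at 1, ∑ conj(φ_k(1)) φ_k, gives equality in the Cauchy–Schwarz bound on
point evaluation. -/
theorem Nondegenerate.exists_kernel {σ : Measure Circle} [IsFiniteMeasure σ]
    (hσ : Nondegenerate σ) (n : ℕ) :
    ∃ P : ℂ[X], P.degree < n ∧ ‖P.eval 1‖ = kernelOne σ n ∧ energy σ P = kernelOne σ n := by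
  refine ⟨∑ k ∈ Finset.range n,
    C ((starRingEnd ℂ) ((orthoPoly σ k).eval 1)) * orthoPoly σ k, ?_, ?_, ?_⟩
  · refine degree_sum_lt fun k hk => ?_
    refine (degree_C_mul_le_self _ _).trans_lt ?_
    rw [hσ.degree_orthoPoly]
    exact_mod_cast Finset.mem_range.1 hk
  · rw [eval_finsetSum]
    simp only [eval_mul, eval_C, Complex.conj_mul']
    have : ∑ k ∈ Finset.range n, ((‖(orthoPoly σ k).eval 1‖ : ℂ)) ^ 2
        = ((kernelOne σ n : ℝ) : ℂ) := by
      rw [kernelOne]; push_cast; rfl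
    rw [this, Complex.norm_real, Real.norm_of_nonneg (kernelOne_nonneg σ n)]
  · rw [hσ.energy_sum, kernelOne]
    simp only [RCLike.norm_conj]

/-- Upper bounds for point evaluation bound the kernel. -/
theorem Nondegenerate.kernelOne_le {σ : Measure Circle} [IsFiniteMeasure σ]
    (hσ : Nondegenerate σ) {n : ℕ} {K : ℝ} (hK : 0 ≤ K)
    (h : ∀ P : ℂ[X], P.degree < n → ‖P.eval 1‖ ^ 2 ≤ K * energy σ P) : kernelOne σ n ≤ K := by
  obtain ⟨P, hd, h1, h2⟩ := hσ.exists_kernel n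
  have h3 := h P hd
  rw [h1, h2] at h3
  rcases (kernelOne_nonneg σ n).eq_or_lt with h0 | h0
  · rwa [← h0]
  · nlinarith

theorem energy_add_measure (μ ν : Measure Circle) [IsFiniteMeasure μ] [IsFiniteMeasure ν]
    (P : ℂ[X]) : energy (μ + ν) P = energy μ P + energy ν P :=
  integral_add_measure (continuous_integrable (continuous_normSq_circle P) μ)
    (continuous_integrable (continuous_normSq_circle P) ν)

theorem energy_smul_dirac (s : ℝ) (hs : 0 ≤ s) (P : ℂ[X]) :
    energy (ENNReal.ofReal s • Measure.dirac (1 : Circle)) P = s * ‖P.eval 1‖ ^ 2 := by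
  rw [energy, integral_smul_measure, integral_dirac, ENNReal.toReal_ofReal hs]
  simp

theorem Nondegenerate.add {μ ν : Measure Circle} [IsFiniteMeasure μ] [IsFiniteMeasure ν]
    (hμ : Nondegenerate μ) : Nondegenerate (μ + ν) := fun P hP => by
  rw [energy_add_measure]
  exact add_pos_of_pos_of_nonneg (hμ P hP) (energy_nonneg ν P)

/-- The effect on the kernel at `1` of adding a point mass at `1`. -/
theorem Nondegenerate.kernelOne_add_dirac {μ : Measure Circle} [IsFiniteMeasure μ]
    (hμ : Nondegenerate μ) {s : ℝ} (hs : 0 ≤ s) (n : ℕ) :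
    kernelOne (μ + ENNReal.ofReal s • Measure.dirac 1) n * (1 + s * kernelOne μ n)
      = kernelOne μ n := by
  have : IsFiniteMeasure (ENNReal.ofReal s • Measure.dirac (1 : Circle)) :=
    Measure.smul_finite _ ENNReal.ofReal_ne_top
  set σ := μ + ENNReal.ofReal s • Measure.dirac (1 : Circle) with hσdef
  have hσ : Nondegenerate σ := hμ.add
  have hE : ∀ P, energy σ P = energy μ P + s * ‖P.eval 1‖ ^ 2 := fun P => by
    rw [hσdef, energy_add_measure, energy_smul_dirac s hs]
  -- Each measure's extremal polynomial is tested in the other's inequality. With a, b the kernels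
  -- of σ and μ this gives a² ≤ b(a - sa²) and b² ≤ a(b + sb²), the two halves of the identity.
  obtain ⟨P, hPd, hP1, hP2⟩ := hσ.exists_kernel n
  obtain ⟨Q, hQd, hQ1, hQ2⟩ := hμ.exists_kernel n
  have hP := hμ.norm_eval_one_sq_le hPd
  have hQ := hσ.norm_eval_one_sq_le hQd
  have hP3 := hE P
  have hQ3 := hE Q
  rw [hP1, hP2] at hP3
  rw [hQ1, hQ2] at hQ3
  rw [hP1, show energy μ P = kernelOne σ n - s * kernelOne σ n ^ 2 by linarith] at hP
  rw [hQ1, hQ3] at hQ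
  set a := kernelOne σ n
  set b := kernelOne μ n
  have ha : 0 ≤ a := kernelOne_nonneg σ n
  have hb : 0 ≤ b := kernelOne_nonneg μ n
  have h1 : b ≤ a * (1 + s * b) := by
    rcases hb.eq_or_lt with h0 | h0
    · rw [← h0]; positivity
    · refine le_of_mul_le_mul_left ?_ h0
      linarith
  have h2 : a * (1 + s * b) ≤ b := by
    rcases ha.eq_or_lt with h0 | h0
    · rw [← h0]; linarith
    · refine le_of_mul_le_mul_left ?_ h0
      linarith
  linarith

/-! ### Szegő's lower bound from Jensen's inequality -/

theorem ae_eval_ne_zero {P : ℂ[X]} (hP : P ≠ 0) :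
    ∀ᵐ z : Circle ∂circleLebesgue, P.eval (z : ℂ) ≠ 0 := by
  have hf : {z : Circle | P.eval (z : ℂ) = 0}.Finite := by
    refine Set.Finite.preimage (f := fun z : Circle => (z : ℂ))
      (Subtype.val_injective.injOn) ((P.roots.toFinset.finite_toSet).subset ?_ :
        {x : ℂ | P.eval x = 0}.Finite)
    intro x hx
    simpa [hP] using hx
  rw [ae_iff]
  simpa using hf.measure_zero circleLebesgue

theorem stronglyMeasurable_log_norm_eval (P : ℂ[X]) :
    StronglyMeasurable fun z : Circle => Real.log ‖P.eval (z : ℂ)‖ :=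
  (Real.measurable_log.comp (continuous_eval_circle P).norm.measurable).stronglyMeasurable

theorem integrable_log_norm_eval (P : ℂ[X]) :
    Integrable (fun z : Circle => Real.log ‖P.eval (z : ℂ)‖) circleLebesgue :=
  integrable_circleLebesgue (f := fun z => Real.log ‖P.eval z‖)
    (stronglyMeasurable_log_norm_eval P)
    (analyticOnNhd_id.aeval_polynomial P).meromorphicOn.circleIntegrable_log_norm

theorem integral_log_norm_eval (P : ℂ[X]) :
    ∫ z : Circle, Real.log ‖P.eval (z : ℂ)‖ ∂circleLebesgue = P.logMahlerMeasure := by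
  rw [logMahlerMeasure_def]
  exact integral_circleLebesgue (f := fun z => Real.log ‖P.eval z‖)
    (stronglyMeasurable_log_norm_eval P)

/-- Szegő's lower bound for the `L²(σ)` norm, from Jensen's inequality. -/
theorem exp_le_energy {σ : Measure Circle} [IsFiniteMeasure σ] (hs : IsSzego σ) {P : ℂ[X]}
    (hP : P ≠ 0) :
    Real.exp (2 * P.logMahlerMeasure +
      ∫ z, Real.log (σ.rnDeriv circleLebesgue z).toReal ∂circleLebesgue) ≤ energy σ P := by
  set m := circleLebesgue
  set w := σ.rnDeriv m with hw
  set g : Circle → ℝ := fun z => 2 * Real.log ‖P.eval (z : ℂ)‖ + Real.log (w z).toReal with hg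
  have hgi : Integrable g m := ((integrable_log_norm_eval P).const_mul 2).add hs.2
  set t := ∫ z, g z ∂m with ht
  have ht' : t = 2 * P.logMahlerMeasure + ∫ z, Real.log (w z).toReal ∂m := by
    rw [ht, integral_add ((integrable_log_norm_eval P).const_mul 2) hs.2, integral_const_mul,
      integral_log_norm_eval]
  rw [← ht']
  have hfin : ∀ᵐ z ∂m, w z < ⊤ := Measure.rnDeriv_lt_top σ m
  have hle : m.withDensity w ≤ σ := Measure.withDensity_rnDeriv_le σ m
  have hint : Integrable (fun z : Circle => ‖P.eval (z : ℂ)‖ ^ 2) σ :=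
    continuous_integrable (continuous_normSq_circle P) σ
  have h1 : ∫ z : Circle, (w z).toReal • ‖P.eval (z : ℂ)‖ ^ 2 ∂m ≤ energy σ P := by
    rw [← integral_withDensity_eq_integral_toReal_smul (Measure.measurable_rnDeriv σ m) hfin]
    exact integral_mono_measure hle (ae_of_all _ fun z => by positivity) hint
  have hint2 : Integrable (fun z : Circle => (w z).toReal • ‖P.eval (z : ℂ)‖ ^ 2) m :=
    (integrable_withDensity_iff_integrable_smul' (Measure.measurable_rnDeriv σ m) hfin).1
      (hint.mono_measure hle)
  refine le_trans ?_ h1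
  have hgs : Integrable (fun z => g z - t) m := hgi.sub (integrable_const _)
  -- Jensen through the tangent line at the mean t: e^g ≥ e^t(1 + g - t), whose right side
  -- integrates to e^t.
  have h2 : ∫ z, Real.exp t * (1 + (g z - t)) ∂m = Real.exp t := by
    rw [integral_const_mul, integral_add (integrable_const _) hgs,
      integral_sub hgi (integrable_const _)]
    simp [← ht]
  rw [← h2]
  refine integral_mono_ae (((integrable_const _).add hgs).const_mul _)
    hint2 ?_
  filter_upwards [hfin, hs.1, ae_eval_ne_zero hP] with z hz1 hz2 hz3
  have hwz : 0 < (w z).toReal := ENNReal.toReal_pos hz2.ne' hz1.ne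
  have hPz : 0 < ‖P.eval (z : ℂ)‖ := norm_pos_iff.2 hz3
  have h3 : (w z).toReal • ‖P.eval (z : ℂ)‖ ^ 2 = Real.exp (g z) := by
    rw [hg, Real.exp_add, Real.exp_log hwz, mul_comm 2, Real.exp_mul, Real.exp_log hPz,
      smul_eq_mul, mul_comm]
    norm_num
  show Real.exp t * (1 + (g z - t)) ≤ (w z).toReal • ‖P.eval (z : ℂ)‖ ^ 2
  rw [h3, show Real.exp (g z) = Real.exp t * Real.exp (g z - t) by
    rw [← Real.exp_add]; congr 1; ring]
  gcongr
  linarith [Real.add_one_le_exp (g z - t)]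

theorem IsSzego.nondegenerate {σ : Measure Circle} [IsFiniteMeasure σ] (hs : IsSzego σ) :
    Nondegenerate σ := fun _ hP => (Real.exp_pos _).trans_le (exp_le_energy hs hP)

/-- A monic polynomial has Mahler measure at least 1, so Szegő's bound is uniform in the degree: d
is the exponential of ∫ log σ' dm. -/
theorem IsSzego.exists_le_energy_monicPoly {σ : Measure Circle} [IsFiniteMeasure σ]
    (hs : IsSzego σ) : ∃ d : ℝ, 0 < d ∧ ∀ n, d ≤ energy σ (monicPoly σ n) := by
  refine ⟨_, Real.exp_pos (∫ z, Real.log (σ.rnDeriv circleLebesgue z).toReal ∂circleLebesgue),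
    fun n => le_trans ?_ (exp_le_energy hs (monic_monicPoly σ n).ne_zero)⟩
  have h : 1 ≤ (monicPoly σ n).mahlerMeasure := by
    have := leadingCoeff_le_mahlerMeasure (monicPoly σ n)
    rwa [(monic_monicPoly σ n).leadingCoeff, norm_one] at this
  rw [logMahlerMeasure_eq_log_MahlerMeasure]
  gcongr
  linarith [Real.log_nonneg h]

/-! ### Reversed polynomials and the Szegő recurrence -/

/-- The reversed polynomial `z ^ n * conj (P (1 / conj z))`. -/
noncomputable def starPoly (n : ℕ) (P : ℂ[X]) : ℂ[X] :=
  ∑ k ∈ Finset.range (n + 1), C ((starRingEnd ℂ) (P.coeff k)) * X ^ (n - k)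

theorem Circle.conj_mul_self (z : Circle) : (starRingEnd ℂ) (z : ℂ) * (z : ℂ) = 1 := by
  rw [Complex.conj_mul']
  simp [Circle.norm_coe z]

theorem eval_starPoly {n : ℕ} {P : ℂ[X]} (hP : P.degree < (n + 1 : ℕ)) (z : Circle) :
    (starPoly n P).eval (z : ℂ) = (z : ℂ) ^ n * (starRingEnd ℂ) (P.eval (z : ℂ)) := by
  have hn : P.natDegree < n + 1 := by
    rcases eq_or_ne P 0 with rfl | h
    · simp
    · exact (natDegree_lt_iff_degree_lt h).2 hP
  rw [starPoly, eval_finsetSum, eval_eq_sum_range' hn, map_sum, Finset.mul_sum]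
  refine Finset.sum_congr rfl fun k hk => ?_
  have hk' : k ≤ n := Nat.lt_succ_iff.1 (Finset.mem_range.1 hk)
  have h1 : (z : ℂ) ^ n = (z : ℂ) ^ (n - k) * (z : ℂ) ^ k := by
    rw [← pow_add, Nat.sub_add_cancel hk']
  have h2 : (z : ℂ) ^ k * (starRingEnd ℂ) (z : ℂ) ^ k = 1 := by
    rw [← mul_pow, mul_comm, Circle.conj_mul_self, one_pow]
  simp only [eval_mul, eval_C, eval_pow, eval_X, map_mul, map_pow, h1]
  linear_combination -(starRingEnd ℂ) (P.coeff k) * (z : ℂ) ^ (n - k) * h2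

theorem norm_eval_starPoly {n : ℕ} {P : ℂ[X]} (hP : P.degree < (n + 1 : ℕ)) (z : Circle) :
    ‖(starPoly n P).eval (z : ℂ)‖ = ‖P.eval (z : ℂ)‖ := by
  rw [eval_starPoly hP, norm_mul, norm_pow, Circle.norm_coe, one_pow, one_mul, RCLike.norm_conj]

theorem degree_starPoly_lt (n : ℕ) (P : ℂ[X]) : (starPoly n P).degree < (n + 1 : ℕ) := by
  refine degree_sum_lt fun k _ => (degree_C_mul_le_self _ _).trans_lt ?_
  rw [degree_X_pow]
  exact_mod_cast Nat.lt_succ_of_le (Nat.sub_le n k)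

theorem degree_starPoly_lt_of_coeff_zero {n : ℕ} {P : ℂ[X]} (h : P.coeff 0 = 0) :
    (starPoly n P).degree < (n : ℕ) := by
  refine degree_sum_lt fun k hk => ?_
  have hk' := Finset.mem_range.1 hk
  rcases Nat.eq_zero_or_pos k with rfl | hk0
  · simp [h]
  · refine (degree_C_mul_le_self _ _).trans_lt ?_
    rw [degree_X_pow]
    exact_mod_cast (by omega : n - k < n)

theorem coeff_zero_starPoly (n : ℕ) (P : ℂ[X]) :
    (starPoly n P).coeff 0 = (starRingEnd ℂ) (P.coeff n) := by
  rw [starPoly, finsetSum_coeff, Finset.sum_eq_single_of_mem n (by simp)]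
  · simp
  · intro k hk hkn
    have hk' := Finset.mem_range.1 hk
    rw [coeff_C_mul, coeff_X_pow, if_neg (by omega), mul_zero]

/-- On the circle both integrands are z^n conj(P) conj(Q), which is symmetric in P and Q. -/
theorem polyInner_starPoly (σ : Measure Circle) {n : ℕ} {P Q : ℂ[X]}
    (hP : P.degree < (n + 1 : ℕ)) (hQ : Q.degree < (n + 1 : ℕ)) :
    polyInner σ P (starPoly n Q) = polyInner σ Q (starPoly n P) := by
  rw [polyInner, polyInner]
  congr 1
  ext z
  rw [eval_starPoly hP, eval_starPoly hQ]
  ring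

/-- The Szegő recurrence `z Φ_n - Φ_{n + 1} = e Φ_n^*` together with the norm relation. -/
theorem Nondegenerate.exists_recurrence {σ : Measure Circle} [IsFiniteMeasure σ]
    (hσ : Nondegenerate σ) (n : ℕ) : ∃ e : ℂ,
      X * monicPoly σ n - monicPoly σ (n + 1) = C e * starPoly n (monicPoly σ n) ∧
      ‖e‖ ^ 2 * energy σ (monicPoly σ n) =
        energy σ (monicPoly σ n) - energy σ (monicPoly σ (n + 1)) := by
  set Φ := monicPoly σ n with hΦ
  set E := X * Φ - monicPoly σ (n + 1) with hE
  have hdΦ : Φ.degree < (n + 1 : ℕ) := by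
    rw [hΦ, degree_monicPoly]; exact_mod_cast Nat.lt_succ_self n
  have hmon := monic_monicPoly σ n
  have hmon1 := monic_monicPoly σ (n + 1)
  have hΦn : Φ.coeff n = 1 := by
    have := hmon.leadingCoeff
    rwa [leadingCoeff, natDegree_eq_of_degree_eq_some (degree_monicPoly σ n)] at this
  have hEd : E.degree < (n + 1 : ℕ) := by
    have h1 : (X * Φ).degree = ((n + 1 : ℕ) : WithBot ℕ) := by
      rw [degree_mul, degree_X, hΦ, degree_monicPoly]
      push_cast; ring
    have h2 := degree_sub_lt_left (p := X * Φ) (q := monicPoly σ (n + 1))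
      (by rw [h1, degree_monicPoly]) (mul_ne_zero X_ne_zero hmon.ne_zero)
      (by rw [hmon1.leadingCoeff, (monic_X.mul hmon).leadingCoeff])
    rwa [h1] at h2
  -- Since Φ^* has constant term 1, this e is the only one for which R vanishes at 0. Then R^* has
  -- degree less than n, so R ⊥ Φ^*; and R = XS with deg S < n, so R ⊥ XΦ. Also R ⊥ Φ_{n+1} by
  -- degree, so R is orthogonal to each of its own three terms.
  set e := E.coeff 0 with he
  set R := E - C e * starPoly n Φ with hR
  have hR0 : R.coeff 0 = 0 := by
    rw [hR, coeff_sub, coeff_C_mul, coeff_zero_starPoly, hΦn, map_one, mul_one, sub_self]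
  have hRd : R.degree < (n + 1 : ℕ) := by
    refine (degree_sub_le _ _).trans_lt (max_lt hEd ?_)
    exact (degree_C_mul_le_self _ _).trans_lt (degree_starPoly_lt n Φ)
  have hstar : polyInner σ R (starPoly n Φ) = 0 := by
    rw [polyInner_starPoly σ hRd hdΦ]
    exact polyInner_eq_zero_symm σ
      (hσ.polyInner_monicPoly_of_degree_lt (degree_starPoly_lt_of_coeff_zero hR0))
  have hRX : polyInner σ R (X * Φ) = 0 := by
    obtain ⟨S, hS⟩ := X_dvd_iff.2 hR0
    rw [hS, polyInner_X_mul]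
    refine hσ.polyInner_monicPoly_of_degree_lt ?_
    rcases eq_or_ne S 0 with rfl | hS0
    · simp
    · rw [hS, degree_mul, degree_X, degree_eq_natDegree hS0] at hRd
      rw [degree_eq_natDegree hS0]
      have : 1 + S.natDegree < n + 1 := by exact_mod_cast hRd
      exact_mod_cast (by omega : S.natDegree < n)
  have hRR : polyInner σ R R = 0 := by
    have : R = X * Φ - monicPoly σ (n + 1) - C e * starPoly n Φ := rfl
    conv_lhs => rw [this]
    rw [← this, polyInner_sub_right, polyInner_sub_right, hRX,
      hσ.polyInner_monicPoly_of_degree_lt hRd, polyInner_C_mul_right, hstar]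
    ring
  have hRz : R = 0 := by
    by_contra h
    exact hσ.polyInner_self_ne_zero h hRR
  have hEe : E = C e * starPoly n Φ := sub_eq_zero.1 hRz
  refine ⟨e, hEe, ?_⟩
  -- Φ^* has the norm of Φ, so Pythagoras for XΦ = E + Φ_{n+1} gives the norm relation.
  have h1 : energy σ E = ‖e‖ ^ 2 * energy σ Φ := by
    rw [hEe, energy_C_mul, energy, energy]
    simp only [norm_eval_starPoly hdΦ]
  have h2 : energy σ (X * Φ) = energy σ Φ := by
    have := polyInner_X_mul σ Φ Φ
    rw [polyInner_self, polyInner_self] at this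
    exact_mod_cast this
  have h3 := energy_add_of_orthogonal σ (hσ.polyInner_monicPoly_of_degree_lt hEd)
  rw [hE, sub_add_cancel, h2, ← hE, h1] at h3
  linarith

/-! ### The upper bound o(√n) -/

/-- Cauchy–Schwarz alone gives O(√n). Applied past an index where the tail has ℓ² norm at most c/2,
it gives (c/2)√n, and the finite head is eventually below another (c/2)√n. -/
theorem isLittleO_sum_sqrt {e : ℕ → ℝ} (he : Summable fun n => e n ^ 2) :
    (fun n : ℕ => ∑ k ∈ Finset.range n, |e k|) =o[atTop] fun n : ℕ => √(n : ℝ) := by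
  rw [isLittleO_iff]
  intro c hc
  obtain ⟨K, hK⟩ : ∃ K : ℕ, ∀ n, ∑ k ∈ Finset.range n, e (k + K) ^ 2 ≤ (c / 2) ^ 2 := by
    have h := tendsto_sum_nat_add fun n => e n ^ 2
    obtain ⟨K, hK⟩ := (h.eventually (ge_mem_nhds (by positivity : 0 < (c / 2) ^ 2))).exists
    refine ⟨K, fun n => le_trans ?_ hK⟩
    exact ((summable_nat_add_iff K).2 he).sum_le_tsum _ (fun _ _ => by positivity)
  set A := ∑ k ∈ Finset.range K, |e k|
  have hA : Tendsto (fun n : ℕ => c / 2 * √(n : ℝ)) atTop atTop :=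
    (Real.tendsto_sqrt_atTop.comp tendsto_natCast_atTop_atTop).const_mul_atTop (by positivity)
  filter_upwards [hA.eventually_ge_atTop A, eventually_ge_atTop K] with n hn hnK
  rw [Real.norm_of_nonneg (Finset.sum_nonneg fun _ _ => abs_nonneg _),
    Real.norm_of_nonneg (Real.sqrt_nonneg _)]
  obtain ⟨j, rfl⟩ := Nat.exists_eq_add_of_le hnK
  rw [Finset.sum_range_add]
  have h1 : ∑ k ∈ Finset.range j, |e (K + k)| ≤ c / 2 * √((K + j : ℕ) : ℝ) := by
    have h2 := Finset.sum_mul_sq_le_sq_mul_sq (Finset.range j) (fun k => |e (K + k)|) fun _ => 1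
    simp only [mul_one, sq_abs, one_pow, Finset.sum_const, Finset.card_range, nsmul_eq_mul] at h2
    refine abs_le_of_sq_le_sq' (h2.trans ?_) (by positivity) |>.2
    rw [mul_pow, Real.sq_sqrt (by positivity)]
    have := hK j
    simp only [add_comm _ K] at this
    gcongr
    exact_mod_cast Nat.le_add_left j K
  linarith

/-- From log x ≥ 1 - 1/x the left side is at least x² - x. This bounds entropy integrals below by
the total mass, with no information on the polynomial. -/
theorem neg_one_le_sq_mul_log {x : ℝ} (hx : 0 ≤ x) : -1 ≤ x ^ 2 * Real.log x := by
  rcases hx.eq_or_lt with rfl | hx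
  · simp
  · have h := Real.one_sub_inv_le_log_of_pos hx
    have h2 : x ^ 2 * (1 - x⁻¹) = x ^ 2 - x := by field_simp
    nlinarith [mul_le_mul_of_nonneg_left h (sq_nonneg x)]

theorem continuous_sq_mul_log : Continuous fun x : ℝ => x ^ 2 * Real.log x := by
  have : (fun x : ℝ => x ^ 2 * Real.log x) = fun x => x * (x * Real.log x) := by
    ext x; ring
  rw [this]
  exact continuous_id.mul Real.continuous_mul_log

theorem continuous_entropy_integrand (P : ℂ[X]) :
    Continuous fun z : Circle => ‖P.eval (z : ℂ)‖ ^ 2 * Real.log ‖P.eval (z : ℂ)‖ :=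
  continuous_sq_mul_log.comp (continuous_eval_circle P).norm

theorem neg_le_entropyIntegral (σ : Measure Circle) [IsFiniteMeasure σ] (n : ℕ) :
    -σ.real Set.univ ≤ entropyIntegral σ n := by
  have h : ∫ _ : Circle, (-1 : ℝ) ∂σ ≤ entropyIntegral σ n :=
    integral_mono (integrable_const _)
      (continuous_integrable (continuous_entropy_integrand _) σ)
      fun z => neg_one_le_sq_mul_log (norm_nonneg _)
  simpa using h

theorem norm_eval_orthoPoly (σ : Measure Circle) (n : ℕ) (x : ℂ) :
    ‖(orthoPoly σ n).eval x‖ = (polyNorm σ (monicPoly σ n))⁻¹ * ‖(monicPoly σ n).eval x‖ := by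
  rw [orthoPoly, eval_mul, eval_C, norm_mul, Complex.norm_real,
    Real.norm_of_nonneg (inv_nonneg.2 (by rw [polyNorm_eq]; exact Real.sqrt_nonneg _))]

/-- The entropy integrals of a Szegő measure are `o(√n)`. -/
theorem IsSzego.isLittleO_entropyIntegral {σ : Measure Circle} [IsProbabilityMeasure σ]
    (hs : IsSzego σ) :
    (fun n : ℕ => entropyIntegral σ n) =o[atTop] fun n : ℕ => √(n : ℝ) := by
  have hσ := hs.nondegenerate
  obtain ⟨d, hd, hdn⟩ := hs.exists_le_energy_monicPoly
  choose e he1 he2 using hσ.exists_recurrence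
  have hsum : Summable fun n => ‖e n‖ ^ 2 := by
    refine summable_of_sum_range_le (c := energy σ (monicPoly σ 0) / d)
      (fun _ => by positivity) fun n => ?_
    -- With d below every ‖Φ_k‖², the sum of |e_k|²d is dominated by the telescoping norm
    -- differences.
    rw [le_div_iff₀ hd, Finset.sum_mul]
    calc ∑ k ∈ Finset.range n, ‖e k‖ ^ 2 * d
        ≤ ∑ k ∈ Finset.range n, (energy σ (monicPoly σ k) - energy σ (monicPoly σ (k + 1))) :=
          Finset.sum_le_sum fun k _ => by
            rw [← he2]
            gcongr
            exact hdn k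
      _ = energy σ (monicPoly σ 0) - energy σ (monicPoly σ n) := Finset.sum_range_sub' _ _
      _ ≤ _ := by linarith [energy_nonneg σ (monicPoly σ n)]
  have hsup : ∀ n, ∀ z : Circle, ‖(monicPoly σ n).eval (z : ℂ)‖
      ≤ Real.exp (∑ k ∈ Finset.range n, |‖e k‖|) := by
    intro n z
    induction n with
    | zero => simp [monicPoly_eq σ 0]
    | succ n ih =>
      have h1 : monicPoly σ (n + 1) = X * monicPoly σ n - C (e n) * starPoly n (monicPoly σ n) := by
        rw [← he1]; ring
      have hdΦ : (monicPoly σ n).degree < (n + 1 : ℕ) := by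
        rw [degree_monicPoly]; exact_mod_cast Nat.lt_succ_self n
      rw [h1, eval_sub, eval_mul, eval_mul, eval_X, eval_C, Finset.sum_range_succ, Real.exp_add]
      refine (norm_sub_le _ _).trans ?_
      rw [norm_mul, norm_mul, norm_eval_starPoly hdΦ, Circle.norm_coe, one_mul, abs_norm]
      have h2 := Real.add_one_le_exp ‖e n‖
      calc _ = ‖(monicPoly σ n).eval (z : ℂ)‖ * (‖e n‖ + 1) := by ring
        _ ≤ _ := by gcongr
  set S : ℕ → ℝ := fun n => ∑ k ∈ Finset.range n, |‖e k‖| with hS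
  have hupper : ∀ n, entropyIntegral σ n ≤ S n - Real.log √d := by
    intro n
    have hN : √d ≤ polyNorm σ (monicPoly σ n) := Real.sqrt_le_sqrt (hdn n)
    have hd' : 0 < √d := Real.sqrt_pos.2 hd
    have hpt : ∀ z : Circle, ‖(orthoPoly σ n).eval (z : ℂ)‖ ^ 2 *
        Real.log ‖(orthoPoly σ n).eval (z : ℂ)‖
        ≤ (S n - Real.log √d) * ‖(orthoPoly σ n).eval (z : ℂ)‖ ^ 2 := by
      intro z
      rcases (norm_nonneg ((orthoPoly σ n).eval (z : ℂ))).eq_or_lt with h0 | h0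
      · rw [← h0]; simp
      · rw [mul_comm]
        gcongr
        have : ‖(orthoPoly σ n).eval (z : ℂ)‖ ≤ Real.exp (S n) / √d := by
          rw [norm_eval_orthoPoly, inv_mul_eq_div]
          gcongr
          exact hsup n z
        refine (Real.log_le_log h0 this).trans ?_
        rw [Real.log_div (Real.exp_ne_zero _) hd'.ne', Real.log_exp]
    calc entropyIntegral σ n
        ≤ ∫ z : Circle, (S n - Real.log √d) * ‖(orthoPoly σ n).eval (z : ℂ)‖ ^ 2 ∂σ :=
          integral_mono (continuous_integrable (continuous_entropy_integrand _) σ)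
            ((continuous_integrable (continuous_normSq_circle _) σ).const_mul _) hpt
      _ = _ := by
          rw [integral_const_mul]
          have := hσ.energy_orthoPoly n
          rw [energy] at this
          rw [this, mul_one]
  -- The 1 comes from the lower bound by the total mass, the logarithm from dividing Φ_n by a norm
  -- at least √d.
  have hconst : (fun _ : ℕ => 1 + |Real.log √d|) =o[atTop] fun n : ℕ => √(n : ℝ) := by
    rw [isLittleO_const_left]
    right
    refine tendsto_norm_atTop_atTop.comp ?_
    exact Real.tendsto_sqrt_atTop.comp tendsto_natCast_atTop_atTop
  refine IsBigO.trans_isLittleO (IsBigO.of_bound 1 (Eventually.of_forall fun n => ?_))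
    ((isLittleO_sum_sqrt hsum).add hconst)
  have hS0 : 0 ≤ S n := Finset.sum_nonneg fun _ _ => abs_nonneg _
  have h1 := hupper n
  have h2 := neg_le_entropyIntegral σ n
  rw [probReal_univ] at h2
  have h3 := neg_abs_le (Real.log √d)
  have h4 := abs_nonneg (Real.log √d)
  rw [one_mul, Real.norm_of_nonneg (by positivity : (0 : ℝ) ≤ S n + (1 + |Real.log √d|)),
    Real.norm_eq_abs, abs_le]
  constructor <;> linarith

/-! ### Weak continuity of orthogonal polynomials and entropy -/

/-- Weak convergence of measures on the circle, tested against continuous functions. -/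
def WeakTendsto {ι : Type*} (σ : ι → Measure Circle) (l : Filter ι) (τ : Measure Circle) : Prop :=
  ∀ f : C(Circle, ℂ), Tendsto (fun i => ∫ z, f z ∂(σ i)) l (𝓝 (∫ z, f z ∂τ))

/-- A polynomial as a continuous function on the circle. -/
noncomputable def circleEval (P : ℂ[X]) : C(Circle, ℂ) :=
  ⟨fun z => P.eval (z : ℂ), continuous_eval_circle P⟩

theorem polyInner_eq_integral (σ : Measure Circle) (P Q : ℂ[X]) :
    polyInner σ P Q = ∫ z, (star (circleEval P) * circleEval Q) z ∂σ := rfl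

section Continuity

variable {ι : Type*} {l : Filter ι} {σ : ι → Measure Circle} {τ : Measure Circle}
  [∀ i, IsFiniteMeasure (σ i)]

/-- Weak convergence tested on 1 makes the total masses converge, so a uniformly small change of the
test function changes the integrals little. -/
theorem WeakTendsto.integral (hw : WeakTendsto σ l τ) {F : ι → C(Circle, ℂ)} {G : C(Circle, ℂ)}
    (hF : Tendsto F l (𝓝 G)) :
    Tendsto (fun i => ∫ z, F i z ∂(σ i)) l (𝓝 (∫ z, G z ∂τ)) := by
  have hmass : Tendsto (fun i => (σ i).real Set.univ) l (𝓝 (τ.real Set.univ)) := by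
    have h := (Complex.continuous_re.tendsto _).comp (hw 1)
    simpa [Function.comp_def] using h
  have h0 : Tendsto (fun i => ∫ z, (F i z - G z) ∂(σ i)) l (𝓝 0) := by
    have h1 : Tendsto (fun i => ‖F i - G‖ * (σ i).real Set.univ) l (𝓝 0) := by
      have := (tendsto_iff_norm_sub_tendsto_zero.1 hF).mul hmass
      simpa using this
    refine squeeze_zero_norm (fun i => ?_) h1
    exact norm_integral_le_of_norm_le_const (ae_of_all _ fun z => (F i - G).norm_coe_le_norm z)
  have h2 := h0.add (hw G)
  rw [zero_add] at h2
  refine h2.congr fun i => ?_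
  rw [integral_sub (continuous_integrable (F i).continuous _)
    (continuous_integrable G.continuous _), sub_add_cancel]

theorem WeakTendsto.polyInner (hw : WeakTendsto σ l τ) {P Q : ι → ℂ[X]} {p q : ℂ[X]}
    (hP : Tendsto (fun i => circleEval (P i)) l (𝓝 (circleEval p)))
    (hQ : Tendsto (fun i => circleEval (Q i)) l (𝓝 (circleEval q))) :
    Tendsto (fun i => polyInner (σ i) (P i) (Q i)) l (𝓝 (polyInner τ p q)) := by
  simp only [polyInner_eq_integral]
  exact hw.integral (((continuous_star.tendsto _).comp hP).mul hQ)

theorem circleEval_C_mul (c : ℂ) (P : ℂ[X]) : circleEval (C c * P) = c • circleEval P := by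
  ext z
  simp [circleEval]

theorem circleEval_sub (P Q : ℂ[X]) : circleEval (P - Q) = circleEval P - circleEval Q := by
  ext z
  simp [circleEval]

theorem circleEval_sum {κ : Type*} (s : Finset κ) (P : κ → ℂ[X]) :
    circleEval (∑ k ∈ s, P k) = ∑ k ∈ s, circleEval (P k) := by
  ext z
  simp [circleEval, eval_finsetSum]

/-- Gram–Schmidt coefficients are quotients of inner products already known to converge. Only the
limit measure has to be nondegenerate, since only the limiting denominators must be nonzero. -/
theorem WeakTendsto.monicPoly (hw : WeakTendsto σ l τ) (hτ : Nondegenerate τ) (n : ℕ) :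
    Tendsto (fun i => circleEval (OPUC.monicPoly (σ i) n)) l
      (𝓝 (circleEval (OPUC.monicPoly τ n))) := by
  induction n using Nat.strong_induction_on with
  | _ n ih =>
    have h : ∀ μ : Measure Circle, circleEval (OPUC.monicPoly μ n) = circleEval (X ^ n) -
        ∑ k ∈ Finset.range n, (OPUC.polyInner μ (OPUC.monicPoly μ k) (X ^ n) /
          OPUC.polyInner μ (OPUC.monicPoly μ k) (OPUC.monicPoly μ k)) •
          circleEval (OPUC.monicPoly μ k) := fun μ => by
      rw [monicPoly_eq, circleEval_sub, circleEval_sum]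
      simp only [circleEval_C_mul]
    simp only [h]
    refine tendsto_const_nhds.sub (tendsto_finsetSum _ fun k hk => ?_)
    have hk' := ih k (Finset.mem_range.1 hk)
    exact ((hw.polyInner hk' tendsto_const_nhds).div (hw.polyInner hk' hk')
      (hτ.polyInner_self_ne_zero (monic_monicPoly τ k).ne_zero)).smul hk'

theorem WeakTendsto.orthoPoly (hw : WeakTendsto σ l τ) (hτ : Nondegenerate τ) (n : ℕ) :
    Tendsto (fun i => circleEval (OPUC.orthoPoly (σ i) n)) l
      (𝓝 (circleEval (OPUC.orthoPoly τ n))) := by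
  have h1 := hw.monicPoly hτ n
  have h2 : Tendsto (fun i => energy (σ i) (OPUC.monicPoly (σ i) n)) l
      (𝓝 (energy τ (OPUC.monicPoly τ n))) := by
    have := (Complex.continuous_re.tendsto _).comp (hw.polyInner h1 h1)
    simpa only [polyInner_self, Function.comp_def, Complex.ofReal_re] using this
  simp only [OPUC.orthoPoly, circleEval_C_mul, polyNorm_eq]
  refine Tendsto.smul ?_ h1
  refine (Complex.continuous_ofReal.tendsto _).comp ?_
  exact (h2.sqrt).inv₀ (Real.sqrt_pos.2 (hτ.energy_monicPoly_pos n)).ne'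

/-- The entropy integrals depend continuously on the measure. -/
theorem WeakTendsto.entropyIntegral (hw : WeakTendsto σ l τ) (hτ : Nondegenerate τ) (n : ℕ) :
    Tendsto (fun i => OPUC.entropyIntegral (σ i) n) l (𝓝 (OPUC.entropyIntegral τ n)) := by
  -- As x² log x extends continuously to 0, postcomposition with ψ preserves uniform convergence of
  -- φ_n on the circle.
  let ψ : C(ℂ, ℂ) := ⟨fun x => ((‖x‖ ^ 2 * Real.log ‖x‖ : ℝ) : ℂ),
    Complex.continuous_ofReal.comp (continuous_sq_mul_log.comp continuous_norm)⟩
  have h1 : Tendsto (fun i => ψ.comp (circleEval (OPUC.orthoPoly (σ i) n))) l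
      (𝓝 (ψ.comp (circleEval (OPUC.orthoPoly τ n)))) :=
    ((ContinuousMap.continuous_postcomp ψ).tendsto _).comp (hw.orthoPoly hτ n)
  have h2 := (Complex.continuous_re.tendsto _).comp (hw.integral h1)
  have h3 : ∀ μ : Measure Circle, (∫ z, ψ.comp (circleEval (OPUC.orthoPoly μ n)) z ∂μ)
      = ((OPUC.entropyIntegral μ n : ℝ) : ℂ) := fun μ => by
    rw [OPUC.entropyIntegral, ← integral_complex_ofReal]
    rfl
  simpa only [h3, Function.comp_def, Complex.ofReal_re] using h2

end Continuity

/-! ### Rescaling -/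

theorem polyInner_smul (σ : Measure Circle) {t : ℝ} (ht : 0 ≤ t) (P Q : ℂ[X]) :
    polyInner (ENNReal.ofReal t • σ) P Q = t * polyInner σ P Q := by
  rw [polyInner, polyInner, integral_smul_measure, ENNReal.toReal_ofReal ht, Complex.real_smul]

theorem monicPoly_smul (σ : Measure Circle) {t : ℝ} (ht : 0 < t) (n : ℕ) :
    monicPoly (ENNReal.ofReal t • σ) n = monicPoly σ n := by
  induction n using Nat.strong_induction_on with
  | _ n ih =>
    rw [monicPoly_eq, monicPoly_eq σ]
    congr 1
    refine Finset.sum_congr rfl fun k hk => ?_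
    rw [ih k (Finset.mem_range.1 hk), polyInner_smul σ ht.le, polyInner_smul σ ht.le,
      mul_div_mul_left _ _ (by exact_mod_cast ht.ne')]

theorem polyNorm_smul (σ : Measure Circle) {t : ℝ} (ht : 0 ≤ t) (P : ℂ[X]) :
    polyNorm (ENNReal.ofReal t • σ) P = √t * polyNorm σ P := by
  rw [polyNorm, polyNorm, integral_smul_measure, ENNReal.toReal_ofReal ht, smul_eq_mul,
    Real.sqrt_mul ht]

/-- The entropy integral of a multiple of a measure. -/
theorem Nondegenerate.entropyIntegral_smul {σ : Measure Circle} [IsFiniteMeasure σ]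
    (hσ : Nondegenerate σ) {t : ℝ} (ht : 0 < t) (n : ℕ) :
    entropyIntegral (ENNReal.ofReal t • σ) n = entropyIntegral σ n - Real.log √t := by
  have hst : 0 < √t := Real.sqrt_pos.2 ht
  have h1 : ∀ x : ℂ, ‖(orthoPoly (ENNReal.ofReal t • σ) n).eval x‖
      = (√t)⁻¹ * ‖(orthoPoly σ n).eval x‖ := fun x => by
    rw [norm_eval_orthoPoly, norm_eval_orthoPoly, monicPoly_smul σ ht, polyNorm_smul σ ht.le,
      mul_inv, mul_assoc]
  have hE : ∫ z : Circle, ‖(orthoPoly σ n).eval (z : ℂ)‖ ^ 2 ∂σ = 1 := hσ.energy_orthoPoly n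
  rw [entropyIntegral, integral_smul_measure, ENNReal.toReal_ofReal ht.le, smul_eq_mul,
    ← integral_const_mul]
  have h2 : ∀ z : Circle, t * (‖(orthoPoly (ENNReal.ofReal t • σ) n).eval (z : ℂ)‖ ^ 2 *
      Real.log ‖(orthoPoly (ENNReal.ofReal t • σ) n).eval (z : ℂ)‖)
      = ‖(orthoPoly σ n).eval (z : ℂ)‖ ^ 2 * Real.log ‖(orthoPoly σ n).eval (z : ℂ)‖
        - Real.log √t * ‖(orthoPoly σ n).eval (z : ℂ)‖ ^ 2 := fun z => by
    rw [h1]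
    rcases (norm_nonneg ((orthoPoly σ n).eval (z : ℂ))).eq_or_lt with h0 | h0
    · rw [← h0]; simp
    · rw [Real.log_mul (inv_pos.2 hst).ne' h0.ne', Real.log_inv, mul_pow, inv_pow,
        Real.sq_sqrt ht.le]
      field_simp
      ring
  simp only [h2]
  rw [integral_sub (continuous_integrable (continuous_entropy_integrand _) σ)
    ((continuous_integrable (continuous_normSq_circle _) σ).const_mul _), integral_const_mul, hE,
    mul_one, entropyIntegral]

/-! ### Weighted Lebesgue measures -/

/-- The measure `w dm`. -/
noncomputable def weighted (w : Circle → ℝ) : Measure Circle :=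
  circleLebesgue.withDensity fun z => ENNReal.ofReal (w z)

theorem integral_weighted {E : Type*} [NormedAddCommGroup E] [NormedSpace ℝ E] {w : Circle → ℝ}
    (hw : AEMeasurable w circleLebesgue) (h0 : ∀ᵐ z ∂circleLebesgue, 0 ≤ w z) (f : Circle → E) :
    ∫ z, f z ∂(weighted w) = ∫ z, w z • f z ∂circleLebesgue := by
  rw [weighted, integral_withDensity_eq_integral_toReal_smul₀ hw.ennreal_ofReal
    (ae_of_all _ fun _ => ENNReal.ofReal_lt_top)]
  refine integral_congr_ae ?_
  filter_upwards [h0] with z hz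
  rw [ENNReal.toReal_ofReal hz]

theorem isFiniteMeasure_weighted {w : Circle → ℝ} (hw : Integrable w circleLebesgue) :
    IsFiniteMeasure (weighted w) := isFiniteMeasure_withDensity_ofReal hw.2

/-! ### Bernstein–Szegő polynomials with real Verblunsky coefficients -/

/-- The monic polynomials `Φ_n` and `Φ_n^*` with real Verblunsky coefficients `α`. -/
noncomputable def szegoPair (α : ℕ → ℝ) : ℕ → ℂ[X] × ℂ[X]
  | 0 => (1, 1)
  | n + 1 => (X * (szegoPair α n).1 - C (α n : ℂ) * (szegoPair α n).2,
      (szegoPair α n).2 - C (α n : ℂ) * (X * (szegoPair α n).1))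

/-- `∏ (1 - α_k ^ 2)`, the squared norm of the monic orthogonal polynomial. -/
noncomputable def verblunskyProd (α : ℕ → ℝ) (n : ℕ) : ℝ := ∏ k ∈ Finset.range n, (1 - α k ^ 2)

/-- The square of the value at `1` of the orthonormal polynomial. -/
noncomputable def valueOneSq (α : ℕ → ℝ) (n : ℕ) : ℝ :=
  ∏ k ∈ Finset.range n, ((1 - α k) / (1 + α k))

section Pair

variable {α : ℕ → ℝ}

theorem eval_szegoPair_succ (n : ℕ) (z : ℂ) :
    (szegoPair α (n + 1)).1.eval z
      = z * (szegoPair α n).1.eval z - α n * (szegoPair α n).2.eval z ∧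
    (szegoPair α (n + 1)).2.eval z
      = (szegoPair α n).2.eval z - α n * (z * (szegoPair α n).1.eval z) := by
  constructor <;> simp [szegoPair]

/-- With a = zΦ_n and b = Φ_n^*, one has |b - αa|² - |a - αb|² = (1 - α²)(|b|² - |a|²), and |αa| <
|b|. So Φ_n^* has no zeros in the closed disk, which makes quotients by it analytic there. -/
theorem szegoPair_disk (hα : ∀ k, |α k| < 1) (n : ℕ) {z : ℂ} (hz : ‖z‖ ≤ 1) :
    ‖(szegoPair α n).1.eval z‖ ≤ ‖(szegoPair α n).2.eval z‖ ∧ (szegoPair α n).2.eval z ≠ 0 := by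
  induction n with
  | zero => simp [szegoPair]
  | succ n ih =>
    obtain ⟨h1, h2⟩ := eval_szegoPair_succ (α := α) n z
    rw [h1, h2]
    set a := z * (szegoPair α n).1.eval z
    set b := (szegoPair α n).2.eval z
    have hab : ‖a‖ ≤ ‖b‖ := by
      rw [norm_mul]
      exact (mul_le_of_le_one_left (norm_nonneg _) hz).trans ih.1
    have hb : 0 < ‖b‖ := norm_pos_iff.2 ih.2
    have hαn := hα n
    constructor
    · refine le_of_sq_le_sq ?_ (norm_nonneg _)
      rw [← Complex.normSq_eq_norm_sq, ← Complex.normSq_eq_norm_sq, Complex.normSq_sub,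
        Complex.normSq_sub]
      have e1 : (a * (starRingEnd ℂ) ((α n : ℂ) * b)).re
          = (b * (starRingEnd ℂ) ((α n : ℂ) * a)).re := by
        simp; ring
      rw [e1, Complex.normSq_mul (α n : ℂ), Complex.normSq_mul (α n : ℂ), Complex.normSq_ofReal,
        Complex.normSq_eq_norm_sq, Complex.normSq_eq_norm_sq]
      have e2 : ‖a‖ ^ 2 ≤ ‖b‖ ^ 2 := by gcongr
      have e3 : α n * α n ≤ 1 := by
        rw [← abs_mul_abs_self]; nlinarith [abs_nonneg (α n)]
      nlinarith
    · intro h0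
      have h3 : b = α n * a := sub_eq_zero.1 h0
      have h4 : ‖b‖ = |α n| * ‖a‖ := by
        conv_lhs => rw [h3]
        rw [norm_mul, Complex.norm_real, Real.norm_eq_abs]
      nlinarith [abs_nonneg (α n), norm_nonneg a]

/-- This identifies the two components as reversals of each other; in particular they have equal
modulus on the circle. -/
theorem szegoPair_circle (n : ℕ) (z : Circle) :
    (szegoPair α n).1.eval (z : ℂ)
      = (z : ℂ) ^ n * (starRingEnd ℂ) ((szegoPair α n).2.eval (z : ℂ)) ∧
    (szegoPair α n).2.eval (z : ℂ)
      = (z : ℂ) ^ n * (starRingEnd ℂ) ((szegoPair α n).1.eval (z : ℂ)) := by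
  induction n with
  | zero => simp [szegoPair]
  | succ n ih =>
    obtain ⟨h1, h2⟩ := eval_szegoPair_succ (α := α) n (z : ℂ)
    have hz := Circle.conj_mul_self z
    rw [h1, h2]
    simp only [map_sub, map_mul, Complex.conj_ofReal]
    obtain ⟨i1, i2⟩ := ih
    constructor
    · linear_combination (z : ℂ) * i1 - (α n : ℂ) * i2 +
        (α n : ℂ) * (z : ℂ) ^ n * (starRingEnd ℂ) ((szegoPair α n).1.eval (z : ℂ)) * hz
    · linear_combination i2 - (α n : ℂ) * (z : ℂ) * i1 +
        (z : ℂ) ^ n * (starRingEnd ℂ) ((szegoPair α n).1.eval (z : ℂ)) * (-hz)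

theorem norm_szegoPair_circle (n : ℕ) (z : Circle) :
    ‖(szegoPair α n).1.eval (z : ℂ)‖ = ‖(szegoPair α n).2.eval (z : ℂ)‖ := by
  rw [(szegoPair_circle n z).1, norm_mul, norm_pow, Circle.norm_coe, one_pow, one_mul,
    RCLike.norm_conj]

theorem coeff_szegoPair (n : ℕ) : (szegoPair α n).1.degree < (n + 1 : ℕ) ∧
    (szegoPair α n).2.degree < (n + 1 : ℕ) ∧ (szegoPair α n).1.coeff n = 1 := by
  induction n with
  | zero => simp [szegoPair]
  | succ n ih =>
    obtain ⟨h1, h2, h3⟩ := ih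
    rw [degree_lt_iff_coeff_zero] at h1 h2
    refine ⟨?_, ?_, ?_⟩
    · rw [degree_lt_iff_coeff_zero]
      intro m hm
      obtain ⟨m, rfl⟩ : ∃ j, m = j + 1 := ⟨m - 1, by omega⟩
      simp [szegoPair, coeff_X_mul, h1 m (by omega), h2 (m + 1) (by omega)]
    · rw [degree_lt_iff_coeff_zero]
      intro m hm
      obtain ⟨m, rfl⟩ : ∃ j, m = j + 1 := ⟨m - 1, by omega⟩
      simp [szegoPair, coeff_X_mul, h1 m (by omega), h2 (m + 1) (by omega)]
    · simp [szegoPair, coeff_X_mul, h3, h2 (n + 1) le_rfl]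

theorem verblunskyProd_pos (hα : ∀ k, |α k| < 1) (n : ℕ) : 0 < verblunskyProd α n :=
  Finset.prod_pos fun k _ => by
    have := (sq_lt_one_iff_abs_lt_one (α k)).2 (hα k)
    linarith

theorem valueOneSq_pos (hα : ∀ k, |α k| < 1) (n : ℕ) : 0 < valueOneSq α n :=
  Finset.prod_pos fun k _ => by
    have := abs_lt.1 (hα k)
    exact div_pos (by linarith) (by linarith)

/-- At z = 1 both components equal ∏(1 - α_k), and (1 - α)² = ((1 - α)/(1 + α))(1 - α²). Negative
coefficients therefore make the value at 1 large. -/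
theorem eval_one_szegoPair (hα : ∀ k, |α k| < 1) (n : ℕ) :
    ‖(szegoPair α n).1.eval 1‖ ^ 2 = valueOneSq α n * verblunskyProd α n := by
  have h : ∀ n, (szegoPair α n).1.eval 1 = ((∏ k ∈ Finset.range n, (1 - α k) : ℝ) : ℂ) ∧
      (szegoPair α n).2.eval 1 = ((∏ k ∈ Finset.range n, (1 - α k) : ℝ) : ℂ) := fun n => by
    induction n with
    | zero => simp [szegoPair]
    | succ n ih =>
      obtain ⟨h1, h2⟩ := eval_szegoPair_succ (α := α) n 1
      rw [h1, h2, ih.1, ih.2, Finset.prod_range_succ]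
      push_cast
      constructor <;> ring
  rw [(h n).1, Complex.norm_real, Real.norm_eq_abs, sq_abs, valueOneSq, verblunskyProd,
    ← Finset.prod_mul_distrib, ← Finset.prod_pow]
  refine Finset.prod_congr rfl fun k _ => ?_
  have := abs_lt.1 (hα k)
  have h2 : (1 + α k) ≠ 0 := by linarith
  field_simp
  ring

/-- The Bernstein–Szegő weight `∏ (1 - α_k ^ 2) / |Φ_n^*| ^ 2`. -/
noncomputable def bsWeight (α : ℕ → ℝ) (n : ℕ) (z : Circle) : ℝ :=
  verblunskyProd α n / ‖(szegoPair α n).2.eval (z : ℂ)‖ ^ 2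

theorem bsWeight_pos (hα : ∀ k, |α k| < 1) (n : ℕ) (z : Circle) : 0 < bsWeight α n z :=
  div_pos (verblunskyProd_pos hα n)
    (pow_pos (norm_pos_iff.2 (szegoPair_disk hα n (Circle.norm_coe z).le).2) 2)

theorem continuous_bsWeight (hα : ∀ k, |α k| < 1) (n : ℕ) : Continuous (bsWeight α n) :=
  continuous_const.div (continuous_normSq_circle _) fun z =>
    (pow_pos (norm_pos_iff.2 (szegoPair_disk hα n (Circle.norm_coe z).le).2) 2).ne'

theorem energy_bsWeight (hα : ∀ k, |α k| < 1) (n : ℕ) (P : ℂ[X]) :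
    energy (weighted (bsWeight α n)) P
      = ∫ z : Circle, bsWeight α n z * ‖P.eval (z : ℂ)‖ ^ 2 ∂circleLebesgue :=
  integral_weighted (continuous_bsWeight hα n).aemeasurable
    (ae_of_all _ fun z => (bsWeight_pos hα n z).le) _

/-- The quotient is analytic on the closed disk and vanishes at 0, so the mean value property
applies. -/
theorem integral_eval_div_eq_zero (hα : ∀ k, |α k| < 1) (P : ℂ[X]) (j k : ℕ)
    (h0 : P.eval 0 = 0) :
    ∫ z : Circle, P.eval (z : ℂ) /
      ((szegoPair α j).2.eval (z : ℂ) * (szegoPair α k).2.eval (z : ℂ)) ∂circleLebesgue = 0 := by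
  have h := integral_circleLebesgue_eq_zero_value (f := fun z => P.eval z /
      ((szegoPair α j).2.eval z * (szegoPair α k).2.eval z)) fun z hz => by
    have hz' : ‖z‖ ≤ 1 := by simpa using hz
    exact P.differentiableAt.div (Polynomial.differentiableAt _ |>.mul
      (Polynomial.differentiableAt _))
      (mul_ne_zero (szegoPair_disk hα j hz').2 (szegoPair_disk hα k hz').2)
  rw [h, h0, zero_div]

/-- Consecutive weights differ by the real part of an analytic function with a zero of order n + 1
at 0, so they agree on trigonometric polynomials of degree at most n. The computation expands
|Φ_{n+1}^*|² by the recurrence. -/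
theorem bsWeight_succ_sub (hα : ∀ k, |α k| < 1) (n : ℕ) (z : Circle) :
    bsWeight α (n + 1) z - bsWeight α n z = 2 * verblunskyProd α n * α n *
      ((z : ℂ) ^ (n + 1) / ((szegoPair α n).2.eval (z : ℂ) *
        (szegoPair α (n + 1)).2.eval (z : ℂ))).re := by
  have hb := (szegoPair_disk hα n (Circle.norm_coe z).le).2
  have hb' := (szegoPair_disk hα (n + 1) (Circle.norm_coe z).le).2
  have hc := szegoPair_circle (α := α) n z
  have hn := norm_szegoPair_circle (α := α) n z
  have hs := (eval_szegoPair_succ (α := α) n (z : ℂ)).2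
  rw [bsWeight, bsWeight, verblunskyProd, verblunskyProd, Finset.prod_range_succ]
  set c := ∏ k ∈ Finset.range n, (1 - α k ^ 2)
  set a := (szegoPair α n).1.eval (z : ℂ)
  set b := (szegoPair α n).2.eval (z : ℂ)
  set b' := (szegoPair α (n + 1)).2.eval (z : ℂ)
  have e1 : (z : ℂ) ^ (n + 1) / (b * b')
      = ((z : ℂ) * a * (starRingEnd ℂ) b') / ((‖b‖ ^ 2 * ‖b'‖ ^ 2 : ℝ) : ℂ) := by
    have f1 : (starRingEnd ℂ) b ≠ 0 := by simpa using hb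
    have f2 : (starRingEnd ℂ) b' ≠ 0 := by simpa using hb'
    push_cast
    rw [← Complex.conj_mul', ← Complex.conj_mul', hc.1]
    field_simp
    ring
  have e2 : ((z : ℂ) * a * (starRingEnd ℂ) b').re
      = ((z : ℂ) * a * (starRingEnd ℂ) b).re - α n * ‖b‖ ^ 2 := by
    rw [hs, map_sub, map_mul, Complex.conj_ofReal, mul_sub, Complex.sub_re]
    congr 1
    rw [show (z : ℂ) * a * ((α n : ℂ) * (starRingEnd ℂ) ((z : ℂ) * a))
      = (α n : ℂ) * ((starRingEnd ℂ) ((z : ℂ) * a) * ((z : ℂ) * a)) by ring,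
      Complex.conj_mul', norm_mul, Circle.norm_coe, one_mul, hn]
    norm_cast
  have e3 : ‖b'‖ ^ 2 = ‖b‖ ^ 2 - 2 * α n * ((z : ℂ) * a * (starRingEnd ℂ) b).re
      + α n ^ 2 * ‖b‖ ^ 2 := by
    rw [hs, ← Complex.normSq_eq_norm_sq, Complex.normSq_sub, Complex.normSq_mul,
      Complex.normSq_ofReal, Complex.normSq_eq_norm_sq, Complex.normSq_eq_norm_sq, norm_mul,
      Circle.norm_coe, one_mul, hn]
    have : (b * (starRingEnd ℂ) ((α n : ℂ) * ((z : ℂ) * a))).re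
        = α n * ((z : ℂ) * a * (starRingEnd ℂ) b).re := by
      simp; ring
    rw [this]; ring
  rw [e1, Complex.div_ofReal_re, e2]
  have h1 : ‖b‖ ≠ 0 := norm_ne_zero_iff.2 hb
  have h2 : ‖b'‖ ≠ 0 := norm_ne_zero_iff.2 hb'
  field_simp
  linear_combination (-c) * e3

/-- Consistency of the Bernstein–Szegő measures. -/
theorem energy_bsWeight_succ (hα : ∀ k, |α k| < 1) {n : ℕ} {P : ℂ[X]}
    (hP : P.degree < (n + 1 : ℕ)) :
    energy (weighted (bsWeight α (n + 1))) P = energy (weighted (bsWeight α n)) P := by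
  have hint : ∀ k, Integrable (fun z : Circle => bsWeight α k z * ‖P.eval (z : ℂ)‖ ^ 2)
      circleLebesgue := fun k =>
    continuous_integrable ((continuous_bsWeight hα k).mul (continuous_normSq_circle P)) _
  rw [energy_bsWeight hα, energy_bsWeight hα, ← sub_eq_zero, ← integral_sub (hint _) (hint _)]
  -- On the circle zPP^* = z^{n+1}|P|², so |P|² times the analytic function in the weight difference
  -- is again analytic, with a zero at 0.
  have h := integral_eval_div_eq_zero hα (X * P * starPoly n P) n (n + 1) (by simp)
  set F : Circle → ℂ := fun z => (X * P * starPoly n P).eval (z : ℂ) /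
      ((szegoPair α n).2.eval (z : ℂ) * (szegoPair α (n + 1)).2.eval (z : ℂ)) with hF
  have hFc : Continuous F := (continuous_eval_circle _).div
    ((continuous_eval_circle _).mul (continuous_eval_circle _)) fun z =>
      mul_ne_zero (szegoPair_disk hα n (Circle.norm_coe z).le).2
        (szegoPair_disk hα (n + 1) (Circle.norm_coe z).le).2
  have hre : ∫ z, (F z).re ∂circleLebesgue = 0 := by
    have := integral_re (𝕜 := ℂ) (continuous_integrable hFc circleLebesgue)
    simp only [RCLike.re_eq_complex_re] at this
    rw [this, h, Complex.zero_re]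
  have hpt : ∀ z : Circle, bsWeight α (n + 1) z * ‖P.eval (z : ℂ)‖ ^ 2 -
      bsWeight α n z * ‖P.eval (z : ℂ)‖ ^ 2
      = 2 * verblunskyProd α n * α n * (F z).re := fun z => by
    rw [← sub_mul, bsWeight_succ_sub hα, mul_assoc]
    congr 1
    have : F z = ((‖P.eval (z : ℂ)‖ ^ 2 : ℝ) : ℂ) * ((z : ℂ) ^ (n + 1) /
        ((szegoPair α n).2.eval (z : ℂ) * (szegoPair α (n + 1)).2.eval (z : ℂ))) := by
      rw [hF]
      simp only [eval_mul, eval_X, eval_starPoly hP]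
      push_cast
      rw [← Complex.conj_mul']
      ring
    rw [this, Complex.re_ofReal_mul, mul_comm]
  simp only [hpt]
  rw [integral_const_mul, hre, mul_zero]

theorem energy_bsWeight_one (hα : ∀ k, |α k| < 1) (n : ℕ) :
    energy (weighted (bsWeight α n)) 1 = 1 := by
  induction n with
  | zero => rw [energy_bsWeight hα]; simp [bsWeight, verblunskyProd, szegoPair]
  | succ n ih =>
    rw [energy_bsWeight_succ hα, ih]
    rw [degree_one]
    exact_mod_cast Nat.succ_pos n

theorem integral_bsWeight (hα : ∀ k, |α k| < 1) (n : ℕ) :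
    ∫ z, bsWeight α n z ∂circleLebesgue = 1 := by
  have h := energy_bsWeight_one hα n
  rw [energy_bsWeight hα] at h
  simpa using h

/-- Against the weight, conj(P)Φ_n becomes a constant times P^*/Φ_n^*, analytic in the disk; it
vanishes at 0 because deg P < n. -/
theorem polyInner_bsWeight (hα : ∀ k, |α k| < 1) {n : ℕ} {P : ℂ[X]} (hP : P.degree < (n : ℕ)) :
    polyInner (weighted (bsWeight α n)) P (szegoPair α n).1 = 0 := by
  have hP' : P.degree < (n + 1 : ℕ) := hP.trans (by exact_mod_cast Nat.lt_succ_self n)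
  -- The second denominator is the one of index 0, which is the constant 1.
  have h := integral_eval_div_eq_zero hα (starPoly n P) n 0 (by
    rw [← coeff_zero_eq_eval_zero, coeff_zero_starPoly, coeff_eq_zero_of_degree_lt hP, map_zero])
  rw [polyInner, integral_weighted (continuous_bsWeight hα n).aemeasurable
    (ae_of_all _ fun z => (bsWeight_pos hα n z).le)]
  have hpt : ∀ z : Circle, bsWeight α n z • ((starRingEnd ℂ) (P.eval (z : ℂ)) *
      (szegoPair α n).1.eval (z : ℂ)) = verblunskyProd α n * ((starPoly n P).eval (z : ℂ) /
      ((szegoPair α n).2.eval (z : ℂ) * (szegoPair α 0).2.eval (z : ℂ))) := fun z => by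
    have hb := (szegoPair_disk hα n (Circle.norm_coe z).le).2
    have hb2 : (starRingEnd ℂ) ((szegoPair α n).2.eval (z : ℂ)) ≠ 0 := by simpa using hb
    have h0 : (szegoPair α 0).2.eval (z : ℂ) = 1 := by simp [szegoPair]
    rw [h0, eval_starPoly hP', (szegoPair_circle n z).1, bsWeight, Complex.real_smul]
    push_cast
    rw [← Complex.conj_mul']
    field_simp
  simp only [hpt]
  rw [integral_const_mul, h, mul_zero]

theorem energy_szegoPair (hα : ∀ k, |α k| < 1) (n : ℕ) :
    energy (weighted (bsWeight α n)) (szegoPair α n).1 = verblunskyProd α n := by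
  rw [energy_bsWeight hα]
  have hpt : ∀ z : Circle, bsWeight α n z * ‖(szegoPair α n).1.eval (z : ℂ)‖ ^ 2
      = verblunskyProd α n := fun z => by
    rw [norm_szegoPair_circle, bsWeight, div_mul_cancel₀]
    exact pow_ne_zero 2 (norm_ne_zero_iff.2 (szegoPair_disk hα n (Circle.norm_coe z).le).2)
  simp [hpt]

/-- Point evaluation at `1` in the `L²` space of a Bernstein–Szegő measure. -/
theorem norm_eval_one_sq_le_bsWeight (hα : ∀ k, |α k| < 1) (n : ℕ) {P : ℂ[X]}
    (hP : P.degree < (n + 1 : ℕ)) : ‖P.eval 1‖ ^ 2 ≤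
      (∑ j ∈ Finset.range (n + 1), valueOneSq α j) * energy (weighted (bsWeight α n)) P := by
  have hfin : ∀ n, IsFiniteMeasure (weighted (bsWeight α n)) := fun n =>
    isFiniteMeasure_weighted (continuous_integrable (continuous_bsWeight hα n) _)
  have hsplit : ∀ n, ∀ P : ℂ[X], P.degree < (n + 1 : ℕ) → ∃ c : ℂ, ∃ R : ℂ[X],
      R.degree < (n : ℕ) ∧ P = R + C c * (szegoPair α n).1 ∧
      energy (weighted (bsWeight α n)) P
        = energy (weighted (bsWeight α n)) R + ‖c‖ ^ 2 * verblunskyProd α n := by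
    intro n P hP
    obtain ⟨h1, -, h3⟩ := coeff_szegoPair (α := α) n
    have hR : (P - C (P.coeff n) * (szegoPair α n).1).degree < (n : ℕ) := by
      rw [degree_lt_iff_coeff_zero] at hP h1 ⊢
      intro m hm
      rw [coeff_sub, coeff_C_mul]
      rcases hm.eq_or_lt with rfl | hm
      · rw [h3, mul_one, sub_self]
      · rw [hP m hm, h1 m hm, mul_zero, sub_zero]
    refine ⟨P.coeff n, P - C (P.coeff n) * (szegoPair α n).1, hR, by ring, ?_⟩
    have := hfin n
    have h := energy_add_of_orthogonal (weighted (bsWeight α n))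
      (P := P - C (P.coeff n) * (szegoPair α n).1) (Q := C (P.coeff n) * (szegoPair α n).1)
      (by rw [polyInner_C_mul_right, polyInner_bsWeight hα hR, mul_zero])
    rwa [sub_add_cancel, energy_C_mul, energy_szegoPair hα] at h
  induction n generalizing P with
  | zero =>
    obtain ⟨c, R, hR, rfl, hE⟩ := hsplit 0 P hP
    have hR0 : R = 0 := by simpa using hR
    rw [hE]
    simp [hR0, valueOneSq, verblunskyProd, szegoPair, energy]
  | succ n ih =>
    obtain ⟨c, R, hR, rfl, hE⟩ := hsplit (n + 1) P hP
    -- Consistency of the weights transfers the lower-degree remainder R to index n, where the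
    -- induction hypothesis applies.
    rw [hE, energy_bsWeight_succ hα hR, Finset.sum_range_succ]
    have h1 := ih hR
    set K := ∑ j ∈ Finset.range (n + 1), valueOneSq α j
    have hK : 0 < K := Finset.sum_pos (fun j _ => valueOneSq_pos hα j) (by simp)
    have h2 := eval_one_szegoPair hα (n + 1)
    have hq := valueOneSq_pos hα (n + 1)
    have hc := verblunskyProd_pos hα (n + 1)
    have hEn := energy_nonneg (weighted (bsWeight α n)) R
    have h3 : ‖(R + C c * (szegoPair α (n + 1)).1).eval 1‖
        ≤ ‖R.eval 1‖ + ‖c‖ * ‖(szegoPair α (n + 1)).1.eval 1‖ := by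
      rw [eval_add, eval_mul, eval_C, ← norm_mul]
      exact norm_add_le _ _
    set E := energy (weighted (bsWeight α n)) R
    set q := valueOneSq α (n + 1)
    set p := verblunskyProd α (n + 1)
    set x := ‖R.eval 1‖
    set y := ‖(szegoPair α (n + 1)).1.eval 1‖
    have hx : 0 ≤ x := norm_nonneg _
    have hy : 0 ≤ y := norm_nonneg _
    have h4 := norm_nonneg c
    -- The cross term of (x + ‖c‖y)², bounded by the arithmetic–geometric mean inequality; it
    -- supplies the mixed terms of the product (K + q)(E + ‖c‖²p).
    have h5 : (2 * x * (‖c‖ * y)) ≤ K * (‖c‖ ^ 2 * p) + q * E := by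
      have h6 : (x * (‖c‖ * y)) ^ 2 ≤ (K * (‖c‖ ^ 2 * p)) * (q * E) := by
        calc (x * (‖c‖ * y)) ^ 2 = x ^ 2 * (‖c‖ ^ 2 * y ^ 2) := by ring
          _ ≤ (K * E) * (‖c‖ ^ 2 * (q * p)) := by rw [h2]; gcongr
          _ = _ := by ring
      have h7 : 0 ≤ K * (‖c‖ ^ 2 * p) := by positivity
      have h8 : 0 ≤ q * E := by positivity
      nlinarith [abs_le_of_sq_le_sq' (a := 2 * (x * (‖c‖ * y)))
        (b := K * (‖c‖ ^ 2 * p) + q * E) (by nlinarith [sq_nonneg (K * (‖c‖ ^ 2 * p) - q * E)])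
        (by positivity)]
    calc _ ≤ (x + ‖c‖ * y) ^ 2 := by gcongr
      _ = x ^ 2 + ‖c‖ ^ 2 * y ^ 2 + 2 * x * (‖c‖ * y) := by ring
      _ ≤ K * E + ‖c‖ ^ 2 * (q * p) + (K * (‖c‖ ^ 2 * p) + q * E) := by
          rw [h2]; gcongr
      _ = _ := by ring

/-- log |Φ_n^*| is harmonic on the closed disk, where Φ_n^* has no zeros, and Φ_n^*(0) = 1. Hence
the weight has mean logarithm log ∏(1 - α_k²). -/
theorem integral_log_norm_szegoPair (hα : ∀ k, |α k| < 1) (n : ℕ) :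
    ∫ z : Circle, Real.log ‖(szegoPair α n).2.eval (z : ℂ)‖ ∂circleLebesgue = 0 := by
  rw [integral_circleLebesgue (f := fun z => Real.log ‖(szegoPair α n).2.eval z‖)
    (stronglyMeasurable_log_norm_eval _), InnerProductSpace.HarmonicOnNhd.circleAverage_eq]
  · have : ∀ n, (szegoPair α n).2.eval 0 = 1 := fun n => by
      induction n with
      | zero => simp [szegoPair]
      | succ n ih => rw [(eval_szegoPair_succ n 0).2, ih]; simp
    rw [this]; simp
  · intro z hz
    have hz' : ‖z‖ ≤ 1 := by simpa using hz
    exact AnalyticAt.harmonicAt_log_norm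
      (analyticAt_id.aeval_polynomial (szegoPair α n).2) (szegoPair_disk hα n hz').2

end Pair

/-! ### Bernstein–Szegő weights near 1 with a large value at 1 -/

/-- Telescoping via 1/m² ≤ 1/(m - 1) - 1/m for J < m ≤ N + J. The point is that the bound does not
depend on N. -/
theorem sum_inv_sq_le (J : ℕ) (hJ : 1 ≤ J) (N : ℕ) :
    ∑ k ∈ Finset.range N, (1 / ((N - k : ℝ) + J)) ^ 2 ≤ (1 / J : ℝ) := by
  have h : ∀ N : ℕ, ∑ k ∈ Finset.range N, (1 / ((N - k : ℝ) + J)) ^ 2 ≤ (1 / J - 1 / (N + J) : ℝ) := by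
    intro N
    have hJ' : (1 : ℝ) ≤ J := by exact_mod_cast hJ
    induction N with
    | zero => simp
    | succ N ih =>
      rw [Finset.sum_range_succ']
      have e : ∑ k ∈ Finset.range N, (1 / (((N + 1 : ℕ) - (k + 1 : ℕ) : ℝ) + J)) ^ 2
          = ∑ k ∈ Finset.range N, (1 / ((N - k : ℝ) + J)) ^ 2 := by
        refine Finset.sum_congr rfl fun k _ => ?_
        push_cast; ring
      rw [e]
      have hy : (0 : ℝ) < N + J := by positivity
      have : (1 / (((N + 1 : ℕ) - (0 : ℕ) : ℝ) + J)) ^ 2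
          ≤ 1 / (N + J) - 1 / ((N + 1 : ℕ) + J) := by
        push_cast
        rw [sub_zero, div_sub_div _ _ hy.ne' (by positivity), div_pow, div_le_div_iff₀ (by positivity)
          (by positivity)]
        nlinarith
      linarith
  refine (h N).trans ?_
  have : (0 : ℝ) ≤ 1 / (N + J) := by positivity
  linarith

/-- Bernstein–Szegő weights `1 / |Q| ^ 2` that are close to `1` and for which point evaluation at
`1` on polynomials of degree `≤ deg Q` is controlled by a large value `|Q(1)| ^ 2`. -/
theorem exists_bernsteinSzego {J : ℕ} (hJ : 4 ≤ J) {ε : ℝ} (hε : 0 < ε) {N : ℕ} (hN : 1 ≤ N)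
    (hεN : ε / √(N : ℝ) ≤ 1 / 4) :
    ∃ Q : ℂ[X], Q.degree < (N + 1 : ℕ) ∧ (∀ z : Circle, Q.eval (z : ℂ) ≠ 0) ∧
      ∫ z : Circle, (‖Q.eval (z : ℂ)‖ ^ 2)⁻¹ ∂circleLebesgue = 1 ∧
      ∫ z : Circle, Real.log (‖Q.eval (z : ℂ)‖ ^ 2) ∂circleLebesgue ≤ 4 / J + 4 * ε ^ 2 ∧
      Real.exp (ε * √(N : ℝ)) ≤ ‖Q.eval 1‖ ^ 2 ∧
      ∀ P : ℂ[X], P.degree < (N + 1 : ℕ) → ‖P.eval 1‖ ^ 2 ≤ ((J + 1) * ‖Q.eval 1‖ ^ 2) *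
        ∫ z : Circle, (‖Q.eval (z : ℂ)‖ ^ 2)⁻¹ * ‖P.eval (z : ℂ)‖ ^ 2 ∂circleLebesgue := by
  have hJ' : (4 : ℝ) ≤ J := by exact_mod_cast hJ
  have hN' : (1 : ℝ) ≤ N := by exact_mod_cast hN
  have hsN : 0 < √(N : ℝ) := Real.sqrt_pos.2 (by linarith)
  -- The constant part gives growth exp(ε√N) at a cost ε² in the sum of squares. The part 1/(N - k +
  -- J) forces the values |φ_j(1)|² to rise fast enough near N that their sum is at most J + 1 times
  -- the last, at a cost of order 1/J.
  set β : ℕ → ℝ := fun k => 1 / ((N - k : ℝ) + J) + ε / √(N : ℝ) with hβ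
  set α : ℕ → ℝ := fun k => if k < N then -β k else 0 with hαdef
  have hβpos : ∀ k < N, 1 / ((N - k : ℝ) + J) ≤ β k ∧ ε / √(N : ℝ) ≤ β k ∧ 0 < β k ∧
      β k ≤ 1 / 2 := by
    intro k hk
    have hk' : (k : ℝ) < N := by exact_mod_cast hk
    have hd : (4 : ℝ) ≤ (N - k : ℝ) + J := by linarith
    have h1 : 0 < 1 / ((N - k : ℝ) + J) := by positivity
    have h2 : 1 / ((N - k : ℝ) + J) ≤ 1 / 4 := one_div_le_one_div_of_le (by norm_num) hd
    have h3 : 0 < ε / √(N : ℝ) := by positivity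
    simp only [hβ]
    refine ⟨by linarith, by linarith, by linarith, by linarith⟩
  have hα : ∀ k, |α k| < 1 := by
    intro k
    simp only [hαdef]
    split_ifs with h
    · obtain ⟨-, -, h3, h4⟩ := hβpos k h
      rw [abs_neg, abs_of_pos h3]; linarith
    · simp
  have hαk : ∀ k < N, α k = -β k := fun k hk => if_pos hk
  set c := verblunskyProd α N with hc
  have hcpos : 0 < c := verblunskyProd_pos hα N
  have hsc : 0 < √c := Real.sqrt_pos.2 hcpos
  set A := (szegoPair α N).1 with hA
  have hQnorm : ∀ x : ℂ, ‖(C (((√c)⁻¹ : ℝ) : ℂ) * A).eval x‖ ^ 2 = c⁻¹ * ‖A.eval x‖ ^ 2 := by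
    intro x
    rw [eval_mul, eval_C, norm_mul, Complex.norm_real, Real.norm_of_nonneg (by positivity),
      mul_pow, inv_pow, Real.sq_sqrt hcpos.le]
  have hAne : ∀ z : Circle, A.eval (z : ℂ) ≠ 0 := fun z => by
    rw [← norm_pos_iff, norm_szegoPair_circle, norm_pos_iff]
    exact (szegoPair_disk hα N (Circle.norm_coe z).le).2
  have hinv : ∀ z : Circle, (‖(C (((√c)⁻¹ : ℝ) : ℂ) * A).eval (z : ℂ)‖ ^ 2)⁻¹
      = bsWeight α N z := fun z => by
    rw [hQnorm, mul_inv, inv_inv, norm_szegoPair_circle]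
    rfl
  have hQ1 : ‖(C (((√c)⁻¹ : ℝ) : ℂ) * A).eval 1‖ ^ 2 = valueOneSq α N := by
    rw [hQnorm, eval_one_szegoPair hα, ← hc]
    field_simp
  have hterm : ∀ k < N, (1 - α k) / (1 + α k) = (1 + β k) / (1 - β k) := fun k hk => by
    rw [hαk k hk]; ring
  refine ⟨C (((√c)⁻¹ : ℝ) : ℂ) * A, ?_, ?_, ?_, ?_, ?_, ?_⟩
  · exact (degree_C_mul_le_self _ _).trans_lt (coeff_szegoPair N).1
  · intro z
    rw [eval_mul, eval_C]
    exact mul_ne_zero (by exact_mod_cast (inv_pos.2 hsc).ne') (hAne z)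
  · simp only [hinv]
    exact integral_bsWeight hα N
  · have hpt : ∀ z : Circle, Real.log (‖(C (((√c)⁻¹ : ℝ) : ℂ) * A).eval (z : ℂ)‖ ^ 2)
        = -Real.log c + 2 * Real.log ‖(szegoPair α N).2.eval (z : ℂ)‖ := fun z => by
      rw [hQnorm, Real.log_mul (inv_pos.2 hcpos).ne'
        (pow_ne_zero 2 (norm_ne_zero_iff.2 (hAne z))), Real.log_inv, Real.log_pow,
        norm_szegoPair_circle]
      norm_num
    simp only [hpt]
    rw [integral_add (integrable_const _) ((integrable_log_norm_eval _).const_mul 2),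
      integral_const_mul, integral_log_norm_szegoPair hα]
    simp only [integral_const, probReal_univ, smul_eq_mul, one_mul, mul_zero, add_zero]
    rw [hc, verblunskyProd, Real.log_prod (fun k _ => by
      have := (sq_lt_one_iff_abs_lt_one (α k)).2 (hα k)
      linarith), ← Finset.sum_neg_distrib]
    calc ∑ k ∈ Finset.range N, -Real.log (1 - α k ^ 2)
        ≤ ∑ k ∈ Finset.range N, (4 * (1 / ((N - k : ℝ) + J)) ^ 2 + 4 * (ε ^ 2 / N)) := by
          refine Finset.sum_le_sum fun k hk => ?_
          have hk' := Finset.mem_range.1 hk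
          obtain ⟨-, -, h3, h4⟩ := hβpos k hk'
          -- -log(1 - x) ≤ 2x for x = β² ≤ 1/4, and β² is at most twice the sum of the squares of
          -- its two parts; hence the factors 4.
          rw [hαk k hk', neg_sq]
          have hx : β k ^ 2 ≤ 1 / 4 := by nlinarith
          have h5 := Real.one_sub_inv_le_log_of_pos (by linarith : 0 < 1 - β k ^ 2)
          have h6 : (1 - β k ^ 2)⁻¹ ≤ 1 + 2 * β k ^ 2 := by
            rw [inv_le_iff_one_le_mul₀ (by linarith)]
            nlinarith [sq_nonneg (β k)]
          have h7 : β k ^ 2 ≤ 2 * (1 / ((N - k : ℝ) + J)) ^ 2 + 2 * (ε ^ 2 / N) := by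
            have h8 : ε ^ 2 / N = (ε / √(N : ℝ)) ^ 2 := by
              rw [div_pow, Real.sq_sqrt (by linarith)]
            rw [h8]
            simp only [hβ]
            nlinarith [sq_nonneg (1 / ((N - k : ℝ) + J) - ε / √(N : ℝ))]
          linarith
      _ = 4 * ∑ k ∈ Finset.range N, (1 / ((N - k : ℝ) + J)) ^ 2 + 4 * ε ^ 2 := by
          rw [Finset.sum_add_distrib, ← Finset.mul_sum, Finset.sum_const, Finset.card_range,
            nsmul_eq_mul]
          field_simp
      _ ≤ 4 * (1 / J) + 4 * ε ^ 2 := by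
          gcongr
          exact sum_inv_sq_le J (by omega) N
      _ = _ := by ring
  · rw [hQ1, valueOneSq]
    calc Real.exp (ε * √(N : ℝ)) = ∏ k ∈ Finset.range N, Real.exp (ε / √(N : ℝ)) := by
          rw [Finset.prod_const, Finset.card_range, ← Real.exp_nat_mul]
          congr 1
          rw [mul_div_assoc', eq_div_iff hsN.ne', mul_assoc, Real.mul_self_sqrt (by linarith)]
          ring
      _ ≤ _ := by
          refine Finset.prod_le_prod (fun _ _ => (Real.exp_pos _).le) fun k hk => ?_
          have hk' := Finset.mem_range.1 hk
          obtain ⟨-, h2, h3, h4⟩ := hβpos k hk'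
          rw [hterm k hk']
          have h5 := Real.add_one_le_exp (-β k)
          have h6 : Real.exp (β k) ≤ 1 / (1 - β k) := by
            rw [le_div_iff₀ (by linarith)]
            calc Real.exp (β k) * (1 - β k) ≤ Real.exp (β k) * Real.exp (-β k) := by
                  gcongr; linarith
              _ = 1 := by rw [← Real.exp_add]; simp
          refine (Real.exp_le_exp.2 h2).trans (h6.trans ?_)
          gcongr
          · linarith
          · linarith
  · intro P hP
    simp only [hinv]
    rw [← energy_bsWeight hα, hQ1]
    refine (norm_eval_one_sq_le_bsWeight hα N hP).trans ?_
    have hE := energy_nonneg (weighted (bsWeight α N)) P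
    gcongr
    -- Induction with y = N - n + J: βy ≥ 1 yields (y + 1)q_n ≤ (y - 1)q_{n+1} for q_n = |φ_n(1)|²,
    -- so the sum up to n + 1 is at most (y - 1 + 1)q_{n+1}. The factor decreases to J + 1 at n = N.
    have key : ∀ n ≤ N, ∑ j ∈ Finset.range (n + 1), valueOneSq α j
        ≤ ((N - n : ℝ) + J + 1) * valueOneSq α n := by
      intro n
      induction n with
      | zero =>
        intro _
        simp only [zero_add, Finset.sum_range_one, valueOneSq, Finset.range_zero,
          Finset.prod_empty, Nat.cast_zero]
        linarith
      | succ n ih =>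
        intro hn
        have ih' := ih (by omega)
        rw [Finset.sum_range_succ]
        have hq := valueOneSq_pos hα n
        have hs : valueOneSq α (n + 1) = valueOneSq α n * ((1 + β n) / (1 - β n)) := by
          rw [valueOneSq, Finset.prod_range_succ, hterm n (by omega)]
          rfl
        obtain ⟨h1, -, h3, h4⟩ := hβpos n (by omega)
        have hnN : (n : ℝ) + 1 ≤ N := by exact_mod_cast hn
        set y := (N - n : ℝ) + J with hy
        have hy0 : 0 < y := by linarith
        have h5 : 1 ≤ β n * y := by rwa [div_le_iff₀ hy0] at h1
        have h6 : (y + 1) * valueOneSq α n ≤ (y - 1) * valueOneSq α (n + 1) := by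
          rw [hs, mul_div_assoc', mul_div_assoc', le_div_iff₀ (by linarith)]
          have : (y + 1) * (1 - β n) ≤ (y - 1) * (1 + β n) := by nlinarith
          nlinarith
        push_cast
        have h7 : (N - (n + 1) : ℝ) + J + 1 = (y - 1) + 1 := by rw [hy]; ring
        rw [h7, add_mul, one_mul]
        linarith
    have := key N le_rfl
    rwa [sub_self, zero_add] at this

/-! ### Exponential weights -/

theorem isSzego_weighted_exp {u : Circle → ℝ} (hu : Integrable u circleLebesgue)
    (he : Integrable (fun z => Real.exp (u z)) circleLebesgue) :
    IsSzego (weighted fun z => Real.exp (u z)) := by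
  have h : (weighted fun z => Real.exp (u z)).rnDeriv circleLebesgue =ᵐ[circleLebesgue]
      fun z => ENNReal.ofReal (Real.exp (u z)) :=
    Measure.rnDeriv_withDensity₀ _ he.aemeasurable.ennreal_ofReal
  constructor
  · filter_upwards [h] with z hz
    rw [hz]
    exact ENNReal.ofReal_pos.2 (Real.exp_pos _)
  · refine hu.congr ?_
    filter_upwards [h] with z hz
    rw [hz, ENNReal.toReal_ofReal (Real.exp_pos _).le, Real.log_exp]

theorem nondegenerate_weighted_exp {u : Circle → ℝ} (hu : Integrable u circleLebesgue)
    (he : Integrable (fun z => Real.exp (u z)) circleLebesgue) :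
    Nondegenerate (weighted fun z => Real.exp (u z)) := by
  have := isFiniteMeasure_weighted he
  exact (isSzego_weighted_exp hu he).nondegenerate

theorem integrable_of_bounded {u : Circle → ℝ} (hm : Measurable u) {C : ℝ}
    (hb : ∀ z, |u z| ≤ C) : Integrable u circleLebesgue :=
  Integrable.of_bound hm.aestronglyMeasurable C (ae_of_all _ hb)

theorem integrable_exp_of_bounded {u : Circle → ℝ} (hm : Measurable u) {C : ℝ}
    (hb : ∀ z, |u z| ≤ C) : Integrable (fun z => Real.exp (u z)) circleLebesgue := by
  refine Integrable.of_bound (Real.measurable_exp.comp hm).aestronglyMeasurable (Real.exp C)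
    (ae_of_all _ fun z => ?_)
  rw [Real.norm_eq_abs, Real.abs_exp]
  exact Real.exp_le_exp.2 ((le_abs_self _).trans (hb z))

/-! ### Kernel growth and the entropy created by a point mass -/

/-- The geometric sum has squared norm L and value L at 1, so as a factor of a test polynomial it
multiplies the ratio |P(1)|²/‖P‖² by L. The induction writes it as 1 plus z times the shorter sum,
which is orthogonal to 1. -/
theorem integral_norm_geomSum_sq (L : ℕ) :
    ∫ z : Circle, ‖(∑ k ∈ Finset.range L, (X : ℂ[X]) ^ k).eval (z : ℂ)‖ ^ 2 ∂circleLebesgue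
      = L := by
  change energy circleLebesgue _ = _
  induction L with
  | zero => simp [energy]
  | succ L ih =>
    have h : ∑ k ∈ Finset.range (L + 1), (X : ℂ[X]) ^ k
        = 1 + X * ∑ k ∈ Finset.range L, (X : ℂ[X]) ^ k := by
      rw [Finset.sum_range_succ', Finset.mul_sum, add_comm]
      congr 1
      exact Finset.sum_congr rfl fun k _ => by ring
    rw [h, energy_add_of_orthogonal]
    · have h2 := polyInner_X_mul circleLebesgue (∑ k ∈ Finset.range L, (X : ℂ[X]) ^ k)
        (∑ k ∈ Finset.range L, (X : ℂ[X]) ^ k)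
      rw [polyInner_self, polyInner_self] at h2
      have h3 : energy circleLebesgue (X * ∑ k ∈ Finset.range L, (X : ℂ[X]) ^ k)
          = energy circleLebesgue (∑ k ∈ Finset.range L, (X : ℂ[X]) ^ k) := by exact_mod_cast h2
      rw [h3, ih]
      simp [energy]
      ring
    · have h2 := integral_circleLebesgue_eq_zero_value
        (f := fun z => (X * ∑ k ∈ Finset.range L, (X : ℂ[X]) ^ k).eval z)
        fun z _ => Polynomial.differentiableAt _
      simpa [polyInner] using h2

/-- A geometric growth of a sequence over `L` steps has a step of definite relative size. -/
theorem exists_large_step {f : ℕ → ℝ} {n L : ℕ} (hL : 1 ≤ L) (hn : 0 < f n)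
    (h : 2 * f n ≤ f (n + L)) :
    ∃ k < L, (1 + 1 / (2 * L)) * f (n + k) ≤ f (n + k + 1) := by
  by_contra! hc
  have hL' : (1 : ℝ) ≤ L := by exact_mod_cast hL
  have hind : ∀ k ≤ L, f (n + k) ≤ (1 + 1 / (2 * L)) ^ k * f n := by
    intro k
    induction k with
    | zero => intro _; simp
    | succ k ih =>
      intro hk
      have h1 := ih (by omega)
      have h2 := hc k (by omega)
      rw [← add_assoc]
      refine h2.le.trans ?_
      rw [pow_succ']
      rw [mul_assoc]
      gcongr
  have h1 := hind L le_rfl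
  -- If every step were smaller, the total growth would be at most e^{1/2} < 2.
  have h2 : (1 + 1 / (2 * L) : ℝ) ^ L ≤ Real.exp (1 / 2) := by
    calc (1 + 1 / (2 * L) : ℝ) ^ L ≤ Real.exp (1 / (2 * L)) ^ L := by
          gcongr
          linarith [Real.add_one_le_exp (1 / (2 * L) : ℝ)]
      _ = Real.exp (1 / 2) := by
          rw [← Real.exp_nat_mul]
          congr 1
          field_simp
  have h3 : Real.exp (1 / 2) < 2 := by
    have h4 := Real.exp_one_lt_d9
    have h5 : Real.exp (1 / 2) ^ 2 = Real.exp 1 := by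
      rw [← Real.exp_nat_mul]; norm_num
    nlinarith [Real.exp_pos (1 / 2)]
  nlinarith

/-- The entropy of a measure with a point mass at `1` of the size of the Christoffel function. -/
theorem Nondegenerate.entropyIntegral_add_dirac_ge {μ : Measure Circle} [IsFiniteMeasure μ]
    (hμ : Nondegenerate μ) {n : ℕ} {c t : ℝ} (hc : 0 < c) (hn : 0 < kernelOne μ (n + 1))
    (hstep : (1 + c) * kernelOne μ n ≤ kernelOne μ (n + 1))
    (ht : Real.exp (2 * t) ≤ c / (2 * (2 + c)) * kernelOne μ (n + 1)) (ht0 : 0 ≤ t) :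
    c / (2 * (2 + c)) * t - μ.real Set.univ ≤
      entropyIntegral (μ + ENNReal.ofReal (kernelOne μ (n + 1))⁻¹ • Measure.dirac 1) n := by
  set K := kernelOne μ (n + 1) with hK
  have hs : 0 < K⁻¹ := inv_pos.2 hn
  have hfin : IsFiniteMeasure (ENNReal.ofReal K⁻¹ • Measure.dirac (1 : Circle)) :=
    Measure.smul_finite _ ENNReal.ofReal_ne_top
  set σ := μ + ENNReal.ofReal K⁻¹ • Measure.dirac (1 : Circle) with hσ
  have h1 : kernelOne σ (n + 1) * (1 + K⁻¹ * K) = K := hμ.kernelOne_add_dirac hs.le (n + 1)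
  have h2 : kernelOne σ n * (1 + K⁻¹ * kernelOne μ n) = kernelOne μ n :=
    hμ.kernelOne_add_dirac hs.le n
  have h3 := kernelOne_succ σ n
  have hk0 := kernelOne_nonneg μ n
  set x := K⁻¹ * kernelOne μ n with hx
  have hx0 : 0 ≤ x := by positivity
  have hx1 : (1 + c) * x ≤ 1 := by
    rw [hx, ← mul_assoc, mul_comm (1 + c), mul_assoc, inv_mul_le_iff₀ hn, mul_one]
    exact hstep
  set φ := ‖(orthoPoly σ n).eval 1‖ with hφ
  -- The atom carries K⁻¹φ² of the unit norm of the orthonormal polynomial. This is the difference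
  -- of K⁻¹ times the new kernels: 1/2 at n + 1, and x/(1 + x) ≤ 1/(2 + c) at n, since x = K_n/K ≤
  -- 1/(1 + c).
  have h4 : c / (2 * (2 + c)) ≤ K⁻¹ * φ ^ 2 := by
    have h5 : K⁻¹ * kernelOne σ (n + 1) = 1 / 2 := by
      rw [inv_mul_cancel₀ hn.ne'] at h1
      field_simp
      linarith
    have h6 : K⁻¹ * kernelOne σ n * (1 + x) = x := by
      rw [mul_assoc, h2]
    have h7 : K⁻¹ * φ ^ 2 = 1 / 2 - K⁻¹ * kernelOne σ n := by
      rw [← h5, h3]; ring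
    have h8 : K⁻¹ * kernelOne σ n = x / (1 + x) := by
      rw [eq_div_iff (by positivity), h6]
    have h9 : x / (1 + x) ≤ 1 / (2 + c) := by
      rw [div_le_div_iff₀ (by positivity) (by positivity)]
      nlinarith
    have h10 : c / (2 * (2 + c)) = 1 / 2 - 1 / (2 + c) := by
      field_simp; ring
    rw [h7, h8, h10]
    linarith
  have hφt : Real.exp t ≤ φ := by
    refine le_of_sq_le_sq ?_ (norm_nonneg _)
    rw [← Real.exp_nat_mul]
    push_cast
    refine ht.trans ?_
    calc c / (2 * (2 + c)) * K ≤ K⁻¹ * φ ^ 2 * K := by gcongr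
      _ = φ ^ 2 := by field_simp
  have hlog : t ≤ Real.log φ := (Real.le_log_iff_exp_le ((Real.exp_pos t).trans_le hφt)).2 hφt
  have hint : ∀ ν : Measure Circle, IsFiniteMeasure ν → Integrable (fun z : Circle =>
      ‖(orthoPoly σ n).eval (z : ℂ)‖ ^ 2 * Real.log ‖(orthoPoly σ n).eval (z : ℂ)‖) ν :=
    fun ν _ => continuous_integrable (continuous_entropy_integrand _) ν
  have hμpart : -μ.real Set.univ ≤ ∫ z : Circle, ‖(orthoPoly σ n).eval (z : ℂ)‖ ^ 2 *
      Real.log ‖(orthoPoly σ n).eval (z : ℂ)‖ ∂μ := by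
    have h : ∫ _ : Circle, (-1 : ℝ) ∂μ ≤ ∫ z : Circle, ‖(orthoPoly σ n).eval (z : ℂ)‖ ^ 2 *
      Real.log ‖(orthoPoly σ n).eval (z : ℂ)‖ ∂μ :=
      integral_mono (integrable_const _) (hint μ inferInstance)
        fun z => neg_one_le_sq_mul_log (norm_nonneg _)
    simpa using h
  rw [entropyIntegral, hσ, integral_add_measure (hint μ inferInstance) (hint _ hfin),
    integral_smul_measure, integral_dirac, ENNReal.toReal_ofReal hs.le, Circle.coe_one, ← hφ,
    smul_eq_mul, ← mul_assoc]
  have : c / (2 * (2 + c)) * t ≤ K⁻¹ * φ ^ 2 * Real.log φ := by gcongr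
  linarith

/-- Kernel estimates for a bounded perturbation of a weight `1 / |Q| ^ 2`. -/
theorem kernelOne_weighted_bounds {w : Circle → ℝ} (hw : Measurable w) {a b : ℝ} (ha : 0 < a)
    (hab : ∀ z, a ≤ w z ∧ w z ≤ b) {Q : ℂ[X]} {N : ℕ} (hQd : Q.degree < (N + 1 : ℕ))
    (hQ : ∀ z : Circle, Q.eval (z : ℂ) ≠ 0) {J : ℝ} (hJ : 0 ≤ J)
    (hQJ : ∀ P : ℂ[X], P.degree < (N + 1 : ℕ) → ‖P.eval 1‖ ^ 2 ≤ (J * ‖Q.eval 1‖ ^ 2) *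
        ∫ z : Circle, (‖Q.eval (z : ℂ)‖ ^ 2)⁻¹ * ‖P.eval (z : ℂ)‖ ^ 2 ∂circleLebesgue)
    {μ : Measure Circle} [IsFiniteMeasure μ] (hμ : Nondegenerate μ)
    (hμw : ∀ f : Circle → ℝ, ∫ z, f z ∂μ
      = ∫ z : Circle, w z * (‖Q.eval (z : ℂ)‖ ^ 2)⁻¹ * f z ∂circleLebesgue) :
    kernelOne μ (N + 1) ≤ J * ‖Q.eval 1‖ ^ 2 / a ∧
    ∀ L : ℕ, (L + 1) * ‖Q.eval 1‖ ^ 2 / b ≤ kernelOne μ (N + 1 + L) := by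
  have hQpos : ∀ z : Circle, 0 < ‖Q.eval (z : ℂ)‖ ^ 2 := fun z =>
    pow_pos (norm_pos_iff.2 (hQ z)) 2
  have hcinv : Continuous fun z : Circle => (‖Q.eval (z : ℂ)‖ ^ 2)⁻¹ :=
    (continuous_normSq_circle Q).inv₀ fun z => (hQpos z).ne'
  have hb : 0 < b := ha.trans_le ((hab 1).1.trans (hab 1).2)
  have hint1 : ∀ P : ℂ[X], Integrable (fun z : Circle => (‖Q.eval (z : ℂ)‖ ^ 2)⁻¹ *
      ‖P.eval (z : ℂ)‖ ^ 2) circleLebesgue := fun P =>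
    continuous_integrable (hcinv.mul (continuous_normSq_circle P)) _
  have hint2 : ∀ P : ℂ[X], Integrable (fun z : Circle => w z * (‖Q.eval (z : ℂ)‖ ^ 2)⁻¹ *
      ‖P.eval (z : ℂ)‖ ^ 2) circleLebesgue := fun P => by
    simp only [mul_assoc]
    refine (hint1 P).bdd_mul hw.aestronglyMeasurable (c := b) (ae_of_all _ fun z => ?_)
    rw [Real.norm_of_nonneg (ha.le.trans (hab z).1)]
    exact (hab z).2
  constructor
  · refine hμ.kernelOne_le (by positivity) fun P hP => ?_
    refine (hQJ P hP).trans ?_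
    rw [div_mul_eq_mul_div, mul_div_assoc]
    gcongr
    rw [le_div_iff₀ ha, energy, hμw, mul_comm, ← integral_const_mul]
    refine integral_mono ((hint1 P).const_mul a) (hint2 P) fun z => ?_
    have := (hab z).1
    have h1 := hQpos z
    show a * ((‖Q.eval (z : ℂ)‖ ^ 2)⁻¹ * ‖P.eval (z : ℂ)‖ ^ 2) ≤ _
    rw [← mul_assoc]
    gcongr
  · intro L
    -- The test polynomial is QD: the factor Q cancels the weight 1/|Q|², leaving at most b‖D‖² =
    -- b(L + 1), while the value at 1 is Q(1)(L + 1).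
    set D : ℂ[X] := ∑ k ∈ Finset.range (L + 1), X ^ k with hD
    have hDd : D.degree < (L + 1 : ℕ) := degree_sum_lt fun k hk => by
      rw [degree_X_pow]
      exact_mod_cast Finset.mem_range.1 hk
    have hdeg : (Q * D).degree < (N + 1 + L : ℕ) := by
      rcases eq_or_ne (Q * D) 0 with h0 | h0
      · rw [h0, degree_zero]; exact WithBot.bot_lt_coe _
      · have hq0 := left_ne_zero_of_mul h0
        have hd0 := right_ne_zero_of_mul h0
        rw [degree_eq_natDegree hq0] at hQd
        rw [degree_eq_natDegree hd0] at hDd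
        rw [degree_mul, degree_eq_natDegree hq0, degree_eq_natDegree hd0]
        have e1 : Q.natDegree < N + 1 := by exact_mod_cast hQd
        have e2 : D.natDegree < L + 1 := by exact_mod_cast hDd
        exact_mod_cast (by omega : Q.natDegree + D.natDegree < N + 1 + L)
    have h1 := hμ.norm_eval_one_sq_le hdeg
    have hD1 : D.eval 1 = ((L + 1 : ℝ) : ℂ) := by
      rw [hD, eval_finsetSum]; simp
    have hE : energy μ (Q * D) ≤ b * (L + 1) := by
      rw [energy, hμw]
      have h2 : b * (L + 1) = ∫ z : Circle, b * ‖D.eval (z : ℂ)‖ ^ 2 ∂circleLebesgue := by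
        rw [integral_const_mul, integral_norm_geomSum_sq]
        push_cast; ring
      rw [h2]
      refine integral_mono (hint2 _)
        ((continuous_integrable (continuous_normSq_circle D) _).const_mul b) fun z => ?_
      have h3 := hQpos z
      show _ ≤ b * ‖D.eval (z : ℂ)‖ ^ 2
      rw [eval_mul, norm_mul, mul_pow, mul_assoc, inv_mul_cancel_left₀ h3.ne']
      exact mul_le_mul_of_nonneg_right (hab z).2 (by positivity)
    rw [eval_mul, norm_mul, mul_pow, hD1, Complex.norm_real,
      Real.norm_of_nonneg (by positivity)] at h1
    rw [div_le_iff₀ hb]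
    have h4 := h1.trans (mul_le_mul_of_nonneg_left hE (kernelOne_nonneg μ _))
    have hL : (0 : ℝ) < L + 1 := by positivity
    refine le_of_mul_le_mul_right ?_ hL
    calc _ = ‖Q.eval 1‖ ^ 2 * (L + 1 : ℝ) ^ 2 := by ring
      _ ≤ _ := h4
      _ = _ := by ring

/-! ### Smearing the point mass into a bump -/

/-- The tangent to the exponential at log(1 + t), with log(1 + t) ≤ t, gives ty ≤ e^y - 1 - y + t²;
take t = ±κ. It turns smallness of ∫(e^v - 1 - v) into L¹ smallness of v. -/
theorem abs_le_exp_sub {κ : ℝ} (h0 : 0 < κ) (h1 : κ < 1) (y : ℝ) :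
    |y| ≤ (Real.exp y - 1 - y) / κ + κ := by
  have tangent : ∀ t : ℝ, -1 < t → t * y ≤ Real.exp y - 1 - y + t ^ 2 := by
    intro t ht
    have ht' : 0 < 1 + t := by linarith
    have h2 := Real.add_one_le_exp (y - Real.log (1 + t))
    rw [Real.exp_sub, Real.exp_log ht', le_div_iff₀ ht'] at h2
    have h3 := Real.log_le_sub_one_of_pos ht'
    nlinarith
  have e : (Real.exp y - 1 - y) / κ + κ = (Real.exp y - 1 - y + κ ^ 2) / κ := by
    field_simp
  rw [e, le_div_iff₀ h0]
  rcases abs_cases y with ⟨h, -⟩ | ⟨h, -⟩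
  · rw [h]
    linarith [tangent κ (by linarith)]
  · rw [h]
    linarith [tangent (-κ) (by linarith)]

/-- The function with integral `s` that is constant on the ball of radius `r` around `1` and zero
elsewhere. -/
noncomputable def bump (s r : ℝ) : Circle → ℝ :=
  (Metric.ball (1 : Circle) r).indicator fun _ => s / circleLebesgue.real (Metric.ball 1 r)

theorem circleLebesgue_real_ball_pos {r : ℝ} (hr : 0 < r) :
    0 < circleLebesgue.real (Metric.ball (1 : Circle) r) :=
  ENNReal.toReal_pos (circleLebesgue_ball_pos hr).ne' (measure_ne_top _ _)

theorem measurable_bump (s r : ℝ) : Measurable (bump s r) :=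
  measurable_const.indicator Metric.isOpen_ball.measurableSet

theorem bump_nonneg {s r : ℝ} (hs : 0 ≤ s) (z : Circle) : 0 ≤ bump s r z :=
  Set.indicator_nonneg (fun _ _ => div_nonneg hs measureReal_nonneg) z

theorem bump_le {s r : ℝ} (hs : 0 ≤ s) (z : Circle) :
    bump s r z ≤ s / circleLebesgue.real (Metric.ball 1 r) :=
  Set.indicator_le_self' (fun _ _ => div_nonneg hs measureReal_nonneg) z

theorem integrable_bump {s r : ℝ} (hs : 0 ≤ s) : Integrable (bump s r) circleLebesgue :=
  integrable_of_bounded (measurable_bump s r) fun z => by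
    rw [abs_of_nonneg (bump_nonneg hs z)]
    exact bump_le hs z

theorem integral_bump (s : ℝ) {r : ℝ} (hr : 0 < r) : ∫ z, bump s r z ∂circleLebesgue = s := by
  have hp := circleLebesgue_real_ball_pos hr
  rw [bump, integral_indicator Metric.isOpen_ball.measurableSet, setIntegral_const, smul_eq_mul]
  field_simp

theorem tendsto_circleLebesgue_ball :
    Tendsto (fun k : ℕ => circleLebesgue.real (Metric.ball (1 : Circle) (1 / ((k : ℝ) + 1))))
      atTop (𝓝 0) := by
  have h := tendsto_measure_iInter_atTop (μ := circleLebesgue)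
    (s := fun k : ℕ => Metric.ball (1 : Circle) (1 / ((k : ℝ) + 1)))
    (fun k => Metric.isOpen_ball.measurableSet.nullMeasurableSet)
    (fun i j hij => Metric.ball_subset_ball (one_div_le_one_div_of_le (by positivity)
      (by gcongr))) ⟨0, measure_ne_top _ _⟩
  have hI : (⋂ k : ℕ, Metric.ball (1 : Circle) (1 / ((k : ℝ) + 1))) = {1} := by
    ext z
    simp only [Set.mem_iInter, Metric.mem_ball, Set.mem_singleton_iff]
    constructor
    · intro hz
      rw [← dist_le_zero]
      exact ge_of_tendsto' tendsto_one_div_add_atTop_nhds_zero_nat fun k => (hz k).le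
    · rintro rfl k
      rw [dist_self]
      positivity
  rw [hI, measure_singleton] at h
  have h2 := (ENNReal.tendsto_toReal ENNReal.zero_ne_top).comp h
  exact h2

theorem tendsto_integral_bump_smul {s : ℝ} (hs : 0 ≤ s) (f : C(Circle, ℂ)) :
    Tendsto (fun k : ℕ => ∫ z, bump s (1 / ((k : ℝ) + 1)) z • f z ∂circleLebesgue) atTop
      (𝓝 (s • f 1)) := by
  rw [Metric.tendsto_atTop]
  intro e he
  have he' : 0 < e / (s + 1) := by positivity
  obtain ⟨δ, hδ, hf⟩ := Metric.continuousAt_iff.1 (f.continuous.continuousAt (x := 1)) _ he'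
  obtain ⟨K, hK⟩ := exists_nat_one_div_lt hδ
  refine ⟨K, fun k hk => ?_⟩
  have hr : 0 < 1 / ((k : ℝ) + 1) := by positivity
  have hrδ : 1 / ((k : ℝ) + 1) < δ :=
    (one_div_le_one_div_of_le (by positivity) (by gcongr)).trans_lt hK
  set r := 1 / ((k : ℝ) + 1)
  have h1 : s • f 1 = ∫ z, bump s r z • f 1 ∂circleLebesgue := by
    rw [integral_smul_const, integral_bump s hr]
  have hib : ∀ g : Circle → ℂ, Continuous g → Integrable (fun z => bump s r z • g z)
      circleLebesgue := fun g hg => by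
    refine (continuous_integrable hg circleLebesgue).bdd_smul
      (s / circleLebesgue.real (Metric.ball 1 r))
      (measurable_bump s r).aestronglyMeasurable (ae_of_all _ fun z => ?_)
    rw [Real.norm_of_nonneg (bump_nonneg hs z)]
    exact bump_le hs z
  rw [dist_eq_norm, h1, ← integral_sub (hib _ f.continuous) (hib _ continuous_const)]
  calc _ ≤ ∫ z, bump s r z * (e / (s + 1)) ∂circleLebesgue := by
        refine norm_integral_le_of_norm_le ((integrable_bump hs).mul_const _)
          (ae_of_all _ fun z => ?_)
        rw [← smul_sub, norm_smul, Real.norm_of_nonneg (bump_nonneg hs z)]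
        by_cases hz : z ∈ Metric.ball (1 : Circle) r
        · have h2 := hf ((Metric.mem_ball.1 hz).trans hrδ)
          rw [dist_eq_norm] at h2
          exact mul_le_mul_of_nonneg_left h2.le (bump_nonneg hs z)
        · simp [bump, hz]
    _ = s * (e / (s + 1)) := by rw [integral_mul_const, integral_bump s hr]
    _ < e := by
        rw [mul_div_assoc', div_lt_iff₀ (by positivity)]
        nlinarith

theorem weakTendsto_weighted_add_bump {W : Circle → ℝ} (hWm : Measurable W)
    (hW : Integrable W circleLebesgue) (hW0 : ∀ z, 0 ≤ W z) {s : ℝ} (hs : 0 ≤ s) :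
    WeakTendsto (fun k : ℕ => weighted fun z => W z + bump s (1 / ((k : ℝ) + 1)) z) atTop
      (weighted W + ENNReal.ofReal s • Measure.dirac 1) := by
  intro f
  have := isFiniteMeasure_weighted hW
  have : IsFiniteMeasure (ENNReal.ofReal s • Measure.dirac (1 : Circle)) :=
    Measure.smul_finite _ ENNReal.ofReal_ne_top
  have hbd : ∀ g : Circle → ℝ, Measurable g → Integrable g circleLebesgue →
      Integrable (fun z => g z • f z) circleLebesgue := fun g _ hg =>
    hg.smul_bdd ‖f‖ f.continuous.aestronglyMeasurable (ae_of_all _ fun z => f.norm_coe_le_norm z)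
  rw [integral_add_measure (continuous_integrable f.continuous _)
    (continuous_integrable f.continuous _), integral_smul_measure, integral_dirac,
    ENNReal.toReal_ofReal hs, integral_weighted hWm.aemeasurable (ae_of_all _ hW0)]
  have h := (tendsto_const_nhds (x := ∫ z, W z • f z ∂circleLebesgue)).add
    (tendsto_integral_bump_smul hs f)
  refine h.congr fun k => ?_
  have hm : Measurable fun z => W z + bump s (1 / ((k : ℝ) + 1)) z :=
    hWm.add (measurable_bump _ _)
  rw [integral_weighted hm.aemeasurable
    (ae_of_all _ fun z => add_nonneg (hW0 z) (bump_nonneg hs z)),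
    ← integral_add (hbd W hWm hW) (hbd _ (measurable_bump _ _) (integrable_bump hs))]
  simp only [add_smul]

/-- The square root makes smearing cheap: height of order 1/p on a set of measure p changes the
logarithm by O(√p) in L¹. -/
theorem log_one_add_le {x : ℝ} (hx : 0 ≤ x) : Real.log (1 + x) ≤ 2 * √x := by
  have h1 : 1 + x ≤ (1 + √x) ^ 2 := by
    nlinarith [Real.sq_sqrt hx, Real.sqrt_nonneg x]
  calc Real.log (1 + x) ≤ Real.log ((1 + √x) ^ 2) := Real.log_le_log (by linarith) h1
    _ = 2 * Real.log (1 + √x) := by rw [Real.log_pow]; norm_num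
    _ ≤ 2 * √x := by
        have := Real.log_le_sub_one_of_pos (by positivity : 0 < 1 + √x)
        linarith

/-- A small point mass at `1` can be replaced by an absolutely continuous measure that hardly
changes the logarithm of the weight. -/
theorem exists_smeared_point_mass {u : Circle → ℝ} (hu : Measurable u) {C : ℝ}
    (hC : ∀ z, |u z| ≤ C) {s : ℝ} (hs : 0 ≤ s) {n : ℕ} {t η : ℝ} (hη : 0 < η)
    (ht : t < entropyIntegral
      ((weighted fun z => Real.exp (u z)) + ENNReal.ofReal s • Measure.dirac 1) n) :
    ∃ u' : Circle → ℝ, Measurable u' ∧ (∃ C', ∀ z, |u' z| ≤ C') ∧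
      ∫ z, |u' z - u z| ∂circleLebesgue < η ∧
      ∫ z, |Real.exp (u' z) - Real.exp (u z)| ∂circleLebesgue ≤ s ∧
      t < entropyIntegral (weighted fun z => Real.exp (u' z)) n := by
  have hui := integrable_of_bounded hu hC
  have hei := integrable_exp_of_bounded hu hC
  have hem : Measurable fun z => Real.exp (u z) := Real.measurable_exp.comp hu
  have hfin := isFiniteMeasure_weighted hei
  have hfin2 : IsFiniteMeasure (ENNReal.ofReal s • Measure.dirac (1 : Circle)) :=
    Measure.smul_finite _ ENNReal.ofReal_ne_top
  have hfin3 : ∀ k : ℕ, IsFiniteMeasure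
      (weighted fun z => Real.exp (u z) + bump s (1 / ((k : ℝ) + 1)) z) := fun k =>
    isFiniteMeasure_weighted (hei.add (integrable_bump hs))
  have hweak := weakTendsto_weighted_add_bump hem hei (fun z => (Real.exp_pos _).le) hs
  have hent := hweak.entropyIntegral (nondegenerate_weighted_exp hui hei).add n
  have hsmall : Tendsto (fun k : ℕ => 2 * √(s * Real.exp C *
      circleLebesgue.real (Metric.ball (1 : Circle) (1 / ((k : ℝ) + 1))))) atTop (𝓝 0) := by
    have := ((tendsto_circleLebesgue_ball.const_mul (s * Real.exp C)).sqrt).const_mul 2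
    simpa using this
  -- The strict entropy inequality survives for all narrow bumps by weak continuity, and the cost to
  -- the logarithm tends to 0.
  obtain ⟨k, hk1, hk2⟩ := ((hent.eventually (lt_mem_nhds ht)).and
    (hsmall.eventually (gt_mem_nhds hη))).exists
  have hr : 0 < 1 / ((k : ℝ) + 1) := by positivity
  set r := 1 / ((k : ℝ) + 1)
  set p := circleLebesgue.real (Metric.ball (1 : Circle) r) with hp
  have hp0 : 0 < p := circleLebesgue_real_ball_pos hr
  have hpos : ∀ z, 0 < Real.exp (u z) + bump s r z := fun z =>
    add_pos_of_pos_of_nonneg (Real.exp_pos _) (bump_nonneg hs z)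
  have hexp : ∀ z, Real.exp (Real.log (Real.exp (u z) + bump s r z))
      = Real.exp (u z) + bump s r z := fun z => Real.exp_log (hpos z)
  have hdiff : ∀ z, 0 ≤ Real.log (Real.exp (u z) + bump s r z) - u z ∧
      Real.log (Real.exp (u z) + bump s r z) - u z ≤
        (Metric.ball (1 : Circle) r).indicator
          (fun _ => 2 * √(s * Real.exp C / p)) z := by
    intro z
    have e1 : Real.log (Real.exp (u z) + bump s r z) - u z
        = Real.log (1 + bump s r z * Real.exp (-u z)) := by
      have e3 : 1 + bump s r z * Real.exp (-u z)
          = (Real.exp (u z) + bump s r z) * Real.exp (-u z) := by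
        rw [add_mul, ← Real.exp_add, add_neg_cancel, Real.exp_zero]
      rw [e3, Real.log_mul (hpos z).ne' (Real.exp_ne_zero _), Real.log_exp, sub_eq_add_neg]
    have h0 : 0 ≤ bump s r z * Real.exp (-u z) :=
      mul_nonneg (bump_nonneg hs z) (Real.exp_pos _).le
    rw [e1]
    refine ⟨Real.log_nonneg (by linarith), ?_⟩
    by_cases hz : z ∈ Metric.ball (1 : Circle) r
    · rw [Set.indicator_of_mem hz]
      refine (log_one_add_le h0).trans ?_
      gcongr
      rw [mul_div_right_comm]
      gcongr
      · exact bump_le hs z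
      · exact (neg_le_abs _).trans (hC z)
    · rw [Set.indicator_of_notMem hz, bump, Set.indicator_of_notMem hz]
      simp
  refine ⟨fun z => Real.log (Real.exp (u z) + bump s r z),
    Real.measurable_log.comp (hem.add (measurable_bump s r)),
    ⟨C + 2 * √(s * Real.exp C / p), fun z => ?_⟩, ?_, ?_, ?_⟩
  · obtain ⟨h1, h2⟩ := hdiff z
    have h3 : (Metric.ball (1 : Circle) r).indicator (fun _ => 2 * √(s * Real.exp C / p)) z
        ≤ 2 * √(s * Real.exp C / p) := Set.indicator_le_self' (fun _ _ => by positivity) z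
    have h4 := abs_le.1 (hC z)
    have h5 : 0 ≤ 2 * √(s * Real.exp C / p) := by positivity
    rw [abs_le]
    constructor <;> linarith
  · calc ∫ z, |Real.log (Real.exp (u z) + bump s r z) - u z| ∂circleLebesgue
        ≤ ∫ z, (Metric.ball (1 : Circle) r).indicator
          (fun _ => 2 * √(s * Real.exp C / p)) z ∂circleLebesgue := by
          refine integral_mono_of_nonneg (ae_of_all _ fun z => abs_nonneg _)
            ((integrable_const _).indicator Metric.isOpen_ball.measurableSet)
            (ae_of_all _ fun z => ?_)
          show |_| ≤ _
          rw [abs_of_nonneg (hdiff z).1]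
          exact (hdiff z).2
      _ = 2 * √(s * Real.exp C * p) := by
          rw [integral_indicator Metric.isOpen_ball.measurableSet, setIntegral_const, smul_eq_mul,
            ← hp]
          have e2 : s * Real.exp C * p = (s * Real.exp C / p) * p ^ 2 := by field_simp
          rw [e2, Real.sqrt_mul (by positivity), Real.sqrt_sq hp0.le]
          ring
      _ < η := hk2
  · simp only [hexp, add_sub_cancel_left, abs_of_nonneg (bump_nonneg hs _)]
    exact (integral_bump s hr).le
  · simpa only [hexp] using hk1

/-! ### Perturbing a bounded weight -/

/-- The window length L and the constants are fixed before N. For N ≥ L every n in the window has √n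
≤ 2√N, so h(n)√n ≤ (cε/4)√N once h ≤ cε/8, half of the leading term on the right. -/
theorem eventually_scale {h : ℕ → ℝ} (hh : Tendsto h atTop (𝓝 0)) {ε b c η : ℝ} (hε : 0 < ε)
    (hc : 0 < c) (hη : 0 < η) (L N₀ : ℕ) : ∃ N : ℕ, 1 ≤ N ∧ N₀ ≤ N ∧ ε / √(N : ℝ) ≤ 1 / 4 ∧
      b * Real.exp (-(ε * √(N : ℝ))) < η ∧ 0 ≤ (ε * √(N : ℝ) + Real.log (c / b)) / 2 ∧
      ∀ n, N ≤ n → n ≤ N + L →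
        h n * √(n : ℝ) < c * ((ε * √(N : ℝ) + Real.log (c / b)) / 2) - b := by
  have hs : Tendsto (fun N : ℕ => √(N : ℝ)) atTop atTop :=
    Real.tendsto_sqrt_atTop.comp tendsto_natCast_atTop_atTop
  have hεs : Tendsto (fun N : ℕ => ε * √(N : ℝ)) atTop atTop := hs.const_mul_atTop hε
  have h2 : ∀ᶠ N : ℕ in atTop, ε / √(N : ℝ) < 1 / 4 :=
    (hs.const_div_atTop ε).eventually (gt_mem_nhds (by norm_num))
  have h3 : ∀ᶠ N : ℕ in atTop, b * Real.exp (-(ε * √(N : ℝ))) < η := by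
    have := (Real.tendsto_exp_neg_atTop_nhds_zero.comp hεs).const_mul b
    rw [mul_zero] at this
    exact this.eventually (gt_mem_nhds hη)
  have h4 : ∀ᶠ N : ℕ in atTop, -Real.log (c / b) ≤ ε * √(N : ℝ) := hεs.eventually_ge_atTop _
  have h5 : ∀ᶠ N : ℕ in atTop, (b - c * Real.log (c / b) / 2) < c / 4 * (ε * √(N : ℝ)) :=
    (hεs.const_mul_atTop (by positivity)).eventually_gt_atTop _
  obtain ⟨N₁, hN₁⟩ := eventually_atTop.1 (hh.eventually
    (gt_mem_nhds (by positivity : (0 : ℝ) < c * ε / 8)))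
  obtain ⟨N, ⟨⟨⟨⟨⟨h1, h2⟩, h3⟩, h4⟩, h5⟩, h6⟩⟩ :=
    (((((eventually_ge_atTop (max (max 1 N₀) (max L N₁))).and h2).and h3).and h4).and h5).and
      (eventually_ge_atTop 1) |>.exists
  have g1 : N₀ ≤ N := (le_max_right _ _).trans ((le_max_left _ _).trans h1)
  have g2 : L ≤ N := (le_max_left _ _).trans ((le_max_right _ _).trans h1)
  have g3 : N₁ ≤ N := (le_max_right _ _).trans ((le_max_right _ _).trans h1)
  refine ⟨N, h6, g1, h2.le, h3, by linarith, fun n hn hnL => ?_⟩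
  have h7 : √(n : ℝ) ≤ 2 * √(N : ℝ) := by
    rw [show (2 : ℝ) = √4 by
      rw [show (4 : ℝ) = 2 ^ 2 by norm_num, Real.sqrt_sq (by norm_num)],
      ← Real.sqrt_mul (by norm_num)]
    apply Real.sqrt_le_sqrt
    exact_mod_cast (by omega : n ≤ 4 * N)
  have h8 := (hN₁ n (g3.trans hn)).le
  calc h n * √(n : ℝ) ≤ c * ε / 8 * (2 * √(N : ℝ)) := by gcongr
    _ = c / 4 * (ε * √(N : ℝ)) := by ring
    _ < _ := by linarith

/-- Any bounded weight has arbitrarily small perturbations with large entropy integrals. -/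
theorem exists_perturbation {h : ℕ → ℝ} (hh : Tendsto h atTop (𝓝 0)) {u : Circle → ℝ}
    (hu : Measurable u) {C : ℝ} (hC : ∀ z, |u z| ≤ C) {η : ℝ} (hη : 0 < η) (N₀ : ℕ) :
    ∃ u' : Circle → ℝ, Measurable u' ∧ (∃ C', ∀ z, |u' z| ≤ C') ∧
      ∫ z, |u' z - u z| ∂circleLebesgue < η ∧
      ∫ z, |Real.exp (u' z) - Real.exp (u z)| ∂circleLebesgue < η ∧
      ∃ n, N₀ ≤ n ∧ h n * √(n : ℝ) < entropyIntegral (weighted fun z => Real.exp (u' z)) n := by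
  set a := Real.exp (-C) with ha
  set b := Real.exp C with hb
  have ha0 : 0 < a := Real.exp_pos _
  have hb0 : 0 < b := Real.exp_pos _
  have hab : ∀ z, a ≤ Real.exp (u z) ∧ Real.exp (u z) ≤ b := fun z =>
    ⟨Real.exp_le_exp.2 (abs_le.1 (hC z)).1, Real.exp_le_exp.2 (abs_le.1 (hC z)).2⟩
  -- κ bounds the Bernstein–Szegő factor e^v: 2κ will bound ∫|v| and κ² + 2κ will bound ∫|e^v - 1|.
  -- Half of η is left for the smeared atom.
  obtain ⟨κ, hκ0, hκ1, hκη, hκb⟩ : ∃ κ : ℝ, 0 < κ ∧ κ < 1 ∧ 2 * κ ≤ η / 2 ∧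
      b * (κ ^ 2 + 2 * κ) ≤ η / 2 := by
    have h1 : min (1 / 2) (η / (8 * (1 + b))) ≤ η / (8 * (1 + b)) := min_le_right _ _
    have h2 : min (1 / 2) (η / (8 * (1 + b))) ≤ 1 / 2 := min_le_left _ _
    have h3 : 0 < min (1 / 2) (η / (8 * (1 + b))) := by positivity
    rw [le_div_iff₀ (by positivity)] at h1
    refine ⟨min (1 / 2) (η / (8 * (1 + b))), h3, by linarith, ?_, ?_⟩
    · nlinarith
    · nlinarith [mul_pos h3 hb0]
  obtain ⟨J, hJ4, hJκ⟩ : ∃ J : ℕ, 4 ≤ J ∧ 4 / (J : ℝ) ≤ κ ^ 2 / 2 := by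
    obtain ⟨J, hJ⟩ := exists_nat_ge (8 / κ ^ 2)
    refine ⟨max 4 J, le_max_left _ _, ?_⟩
    have : (J : ℝ) ≤ (max 4 J : ℕ) := by exact_mod_cast le_max_right 4 J
    have h4 : (4 : ℝ) ≤ (max 4 J : ℕ) := by exact_mod_cast le_max_left 4 J
    rw [div_le_iff₀ (by positivity)] at hJ
    rw [div_le_iff₀ (by linarith)]
    nlinarith [mul_le_mul_of_nonneg_right this (sq_nonneg κ)]
  set ε := κ / 4 with hε
  have hε0 : 0 < ε := by positivity
  -- L makes the lower kernel bound after L extra degrees twice the upper bound at degree N. The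
  -- common factor |Q(1)|² cancels, so L does not depend on N.
  obtain ⟨L, hL1, hL⟩ : ∃ L : ℕ, 1 ≤ L ∧ 2 * (J + 1) / a ≤ (L + 1) / b := by
    obtain ⟨L, hL⟩ := exists_nat_ge (2 * (J + 1) / a * b)
    refine ⟨L + 1, by omega, ?_⟩
    rw [le_div_iff₀ hb0]
    push_cast
    linarith
  set c : ℝ := 1 / (2 * L) with hc
  have hL0 : (0 : ℝ) < L := by exact_mod_cast hL1
  have hc0 : 0 < c := by positivity
  set c' := c / (2 * (2 + c)) with hc'
  have hc'0 : 0 < c' := by positivity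
  obtain ⟨N, hN1, hNN₀, hεN, hNη, hNt, hNent⟩ := eventually_scale (b := b) hh hε0 hc'0
    (half_pos hη) L N₀
  set t := (ε * √(N : ℝ) + Real.log (c' / b)) / 2 with ht
  obtain ⟨Q, hQd, hQ0, hQint, hQlog, hQ1, hQJ⟩ := exists_bernsteinSzego hJ4 hε0 hN1 hεN
  have hQpos : ∀ z : Circle, 0 < ‖Q.eval (z : ℂ)‖ ^ 2 := fun z =>
    pow_pos (norm_pos_iff.2 (hQ0 z)) 2
  set v : Circle → ℝ := fun z => -Real.log (‖Q.eval (z : ℂ)‖ ^ 2) with hv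
  have hvc : Continuous v :=
    ((continuous_normSq_circle Q).log fun z => (hQpos z).ne').neg
  have hgv : ∀ z, Real.exp (v z) = (‖Q.eval (z : ℂ)‖ ^ 2)⁻¹ := fun z => by
    rw [hv, Real.exp_neg, Real.exp_log (hQpos z)]
  obtain ⟨Cv, hCv⟩ : ∃ Cv, ∀ z, |v z| ≤ Cv := by
    obtain ⟨M, hM⟩ := isCompact_univ.exists_bound_of_continuousOn hvc.continuousOn
    exact ⟨M, fun z => hM z (Set.mem_univ z)⟩
  set u₀ : Circle → ℝ := fun z => u z + v z with hu₀
  have hu₀m : Measurable u₀ := hu.add hvc.measurable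
  have hu₀b : ∀ z, |u₀ z| ≤ C + Cv := fun z =>
    (abs_add_le _ _).trans (add_le_add (hC z) (hCv z))
  have hu₀i := integrable_of_bounded hu₀m hu₀b
  have hu₀e := integrable_exp_of_bounded hu₀m hu₀b
  have hui := integrable_of_bounded hu hC
  have hue := integrable_exp_of_bounded hu hC
  set μ := weighted fun z => Real.exp (u₀ z) with hμdef
  have hμfin : IsFiniteMeasure μ := isFiniteMeasure_weighted hu₀e
  have hμ : Nondegenerate μ := nondegenerate_weighted_exp hu₀i hu₀e
  have hexpu₀ : ∀ z, Real.exp (u₀ z) = Real.exp (u z) * (‖Q.eval (z : ℂ)‖ ^ 2)⁻¹ := fun z => by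
    rw [hu₀, Real.exp_add, hgv]
  have hμw : ∀ f : Circle → ℝ, ∫ z, f z ∂μ
      = ∫ z : Circle, Real.exp (u z) * (‖Q.eval (z : ℂ)‖ ^ 2)⁻¹ * f z ∂circleLebesgue := by
    intro f
    rw [hμdef, integral_weighted hu₀e.aemeasurable (ae_of_all _ fun z => (Real.exp_pos _).le)]
    simp only [hexpu₀, smul_eq_mul]
  have hvi : Integrable v circleLebesgue := continuous_integrable hvc _
  have hgi : Integrable (fun z => Real.exp (v z)) circleLebesgue :=
    continuous_integrable (Real.continuous_exp.comp hvc) _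
  have hgint : ∫ z, Real.exp (v z) ∂circleLebesgue = 1 := by
    simp only [hgv]; exact hQint
  have hg1 : Integrable (fun z => Real.exp (v z) - 1) circleLebesgue :=
    hgi.sub (integrable_const 1)
  have hDi : Integrable (fun z => Real.exp (v z) - 1 - v z) circleLebesgue := hg1.sub hvi
  -- As ∫e^v = 1, the integral is -∫v = ∫ log |Q|² ≤ 4/J + 4ε², and J and ε = κ/4 were chosen for
  -- this.
  have hD : ∫ z, (Real.exp (v z) - 1 - v z) ∂circleLebesgue ≤ κ ^ 2 := by
    rw [integral_sub hg1 hvi, integral_sub hgi (integrable_const 1),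
      hgint, hv, integral_neg]
    simp only [integral_const, probReal_univ, smul_eq_mul, mul_one, sub_self, zero_sub, neg_neg]
    refine hQlog.trans ?_
    have : 4 * ε ^ 2 = κ ^ 2 / 4 := by rw [hε]; ring
    nlinarith [sq_nonneg κ]
  have hvabs : ∫ z, |v z| ∂circleLebesgue ≤ 2 * κ := by
    calc ∫ z, |v z| ∂circleLebesgue
        ≤ ∫ z, ((Real.exp (v z) - 1 - v z) / κ + κ) ∂circleLebesgue :=
          integral_mono hvi.abs ((hDi.div_const κ).add (integrable_const κ))
            fun z => abs_le_exp_sub hκ0 hκ1 (v z)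
      _ = (∫ z, (Real.exp (v z) - 1 - v z) ∂circleLebesgue) / κ + κ := by
          rw [integral_add (hDi.div_const κ) (integrable_const κ), integral_div]
          simp
      _ ≤ κ ^ 2 / κ + κ := by gcongr
      _ = 2 * κ := by field_simp; ring
  have hgabs : ∫ z, |Real.exp (v z) - 1| ∂circleLebesgue ≤ κ ^ 2 + 2 * κ := by
    calc ∫ z, |Real.exp (v z) - 1| ∂circleLebesgue
        ≤ ∫ z, ((Real.exp (v z) - 1 - v z) + |v z|) ∂circleLebesgue := by
          refine integral_mono hg1.abs (hDi.add hvi.abs) fun z => ?_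
          show |Real.exp (v z) - 1| ≤ (Real.exp (v z) - 1 - v z) + |v z|
          have h1 := Real.add_one_le_exp (v z)
          have h2 : Real.exp (v z) - 1 = (Real.exp (v z) - 1 - v z) + v z := by ring
          calc |Real.exp (v z) - 1| = |(Real.exp (v z) - 1 - v z) + v z| := by rw [← h2]
            _ ≤ |Real.exp (v z) - 1 - v z| + |v z| := abs_add_le _ _
            _ = _ := by rw [abs_of_nonneg (by linarith : 0 ≤ Real.exp (v z) - 1 - v z)]
      _ ≤ _ := by
          rw [integral_add hDi hvi.abs]
          linarith
  obtain ⟨hK1, hK2⟩ := kernelOne_weighted_bounds (Real.measurable_exp.comp hu) ha0 hab hQd hQ0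
    (by positivity : (0 : ℝ) ≤ J + 1) hQJ hμ hμw
  set q := ‖Q.eval 1‖ ^ 2 with hq
  have hq0 : 0 < q := (Real.exp_pos _).trans_le hQ1
  have hK0 : q / b ≤ kernelOne μ (N + 1) := by
    have := hK2 0
    simpa using this
  have hKpos : 0 < kernelOne μ (N + 1) := (by positivity : 0 < q / b).trans_le hK0
  have hdouble : 2 * kernelOne μ (N + 1) ≤ kernelOne μ (N + 1 + L) := by
    refine le_trans ?_ (hK2 L)
    calc 2 * kernelOne μ (N + 1) ≤ 2 * ((J + 1) * q / a) := by gcongr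
      _ = 2 * (J + 1) / a * q := by ring
      _ ≤ (L + 1) / b * q := by gcongr
      _ = _ := by ring
  obtain ⟨k, hkL, hstep⟩ := exists_large_step hL1 hKpos hdouble
  set n := N + 1 + k with hn
  have hKn : q / b ≤ kernelOne μ (n + 1) :=
    hK0.trans (kernelOne_mono μ (by omega))
  have hKn0 : 0 < kernelOne μ (n + 1) := (by positivity : 0 < q / b).trans_le hKn
  have hexpt : Real.exp (2 * t) ≤ c' * kernelOne μ (n + 1) := by
    calc Real.exp (2 * t) = Real.exp (ε * √(N : ℝ)) * (c' / b) := by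
          rw [ht, mul_div_cancel₀ _ (two_ne_zero), Real.exp_add,
            Real.exp_log (by positivity)]
      _ ≤ q * (c' / b) := by gcongr
      _ = c' * (q / b) := by ring
      _ ≤ _ := by gcongr
  have hent := hμ.entropyIntegral_add_dirac_ge hc0 hKn0 hstep hexpt hNt
  have hμmass : μ.real Set.univ ≤ b := by
    have h1 : μ.real Set.univ = ∫ z, (1 : ℝ) ∂μ := by simp
    rw [h1, hμw]
    simp only [mul_one]
    calc _ ≤ ∫ z, b * Real.exp (v z) ∂circleLebesgue := by
          refine integral_mono_of_nonneg (ae_of_all _ fun z => ?_) (hgi.const_mul b)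
            (ae_of_all _ fun z => ?_)
          · exact mul_nonneg (Real.exp_pos _).le (inv_nonneg.2 (hQpos z).le)
          · show _ ≤ b * Real.exp (v z)
            rw [hgv]
            exact mul_le_mul_of_nonneg_right (hab z).2 (inv_nonneg.2 (hQpos z).le)
      _ = b := by rw [integral_const_mul, hgint, mul_one]
  have hlt : h n * √(n : ℝ) < entropyIntegral
      (μ + ENNReal.ofReal (kernelOne μ (n + 1))⁻¹ • Measure.dirac 1) n := by
    have := hNent n (by omega) (by omega)
    linarith
  obtain ⟨u', hu'm, hu'b, hu'1, hu'2, hu'3⟩ := exists_smeared_point_mass hu₀m hu₀b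
    (inv_pos.2 hKn0).le (half_pos hη) hlt
  -- The atom is at most b/|Q(1)|² ≤ b exp(-ε√N), exponentially small in √N.
  have hs : (kernelOne μ (n + 1))⁻¹ < η / 2 := by
    refine lt_of_le_of_lt ?_ hNη
    rw [Real.exp_neg, ← div_eq_mul_inv, inv_le_comm₀ hKn0 (by positivity), inv_div]
    refine le_trans ?_ hKn
    gcongr
  obtain ⟨C', hC'⟩ := hu'b
  have hu'i := integrable_of_bounded hu'm hC'
  have hu'e := integrable_exp_of_bounded hu'm hC'
  refine ⟨u', hu'm, ⟨C', hC'⟩, ?_, ?_, n, by omega, hu'3⟩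
  · calc ∫ z, |u' z - u z| ∂circleLebesgue
        ≤ ∫ z, (|u' z - u₀ z| + |v z|) ∂circleLebesgue := by
          refine integral_mono (hu'i.sub hui).abs ((hu'i.sub hu₀i).abs.add hvi.abs) fun z => ?_
          show |u' z - u z| ≤ |u' z - u₀ z| + |v z|
          have : u' z - u z = (u' z - u₀ z) + v z := by rw [hu₀]; ring
          rw [this]
          exact abs_add_le _ _
      _ = ∫ z, |u' z - u₀ z| ∂circleLebesgue + ∫ z, |v z| ∂circleLebesgue :=
          integral_add (hu'i.sub hu₀i).abs hvi.abs
      _ < η := by linarith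
  · have hdi : Integrable (fun z => |Real.exp (u' z) - Real.exp (u₀ z)|) circleLebesgue :=
      (hu'e.sub hu₀e).abs
    calc ∫ z, |Real.exp (u' z) - Real.exp (u z)| ∂circleLebesgue
        ≤ ∫ z, (|Real.exp (u' z) - Real.exp (u₀ z)| + b * |Real.exp (v z) - 1|)
            ∂circleLebesgue := by
          refine integral_mono (hu'e.sub hue).abs
            (hdi.add (hg1.abs.const_mul b)) fun z => ?_
          show |Real.exp (u' z) - Real.exp (u z)| ≤
            |Real.exp (u' z) - Real.exp (u₀ z)| + b * |Real.exp (v z) - 1|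
          have h1 : Real.exp (u₀ z) - Real.exp (u z) = Real.exp (u z) * (Real.exp (v z) - 1) := by
            rw [hu₀, Real.exp_add]; ring
          have h2 : |Real.exp (u₀ z) - Real.exp (u z)| ≤ b * |Real.exp (v z) - 1| := by
            rw [h1, abs_mul, Real.abs_exp]
            gcongr
            exact (hab z).2
          exact (abs_sub_le _ (Real.exp (u₀ z)) _).trans (by gcongr)
      _ = ∫ z, |Real.exp (u' z) - Real.exp (u₀ z)| ∂circleLebesgue
            + b * ∫ z, |Real.exp (v z) - 1| ∂circleLebesgue := by
          rw [integral_add hdi (hg1.abs.const_mul b), integral_const_mul]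
      _ < η := by
          have := mul_le_mul_of_nonneg_left hgabs hb0.le
          linarith

/-! ### The Baire space of weights with integrable logarithm -/

theorem weighted_congr {w w' : Circle → ℝ} (h : w =ᵐ[circleLebesgue] w') :
    weighted w = weighted w' :=
  withDensity_congr_ae (h.fun_comp ENNReal.ofReal)

/-- Pairs `(w, log w)` of integrable functions. -/
def logWeights : Set ((Circle →₁[circleLebesgue] ℝ) × (Circle →₁[circleLebesgue] ℝ)) :=
  {x | (x.1 : Circle → ℝ) =ᵐ[circleLebesgue] fun z => Real.exp ((x.2 : Circle → ℝ) z)}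

/-- Along a common subsequence both coordinates converge almost everywhere, so w = e^u passes to the
limit. Closedness makes the space complete; keeping log w as a coordinate keeps limits Szegő. -/
theorem isClosed_logWeights : IsClosed logWeights := by
  refine IsSeqClosed.isClosed fun x y hx hxy => ?_
  have h1 : Tendsto (fun n => (x n).1) atTop (𝓝 y.1) := (continuous_fst.tendsto y).comp hxy
  have h2 : Tendsto (fun n => (x n).2) atTop (𝓝 y.2) := (continuous_snd.tendsto y).comp hxy
  obtain ⟨φ, hφ, hφ'⟩ := (tendstoInMeasure_of_tendsto_Lp h1).exists_seq_tendsto_ae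
  obtain ⟨ψ, hψ, hψ'⟩ :=
    (tendstoInMeasure_of_tendsto_Lp (h2.comp hφ.tendsto_atTop)).exists_seq_tendsto_ae
  have hall : ∀ᵐ z ∂circleLebesgue, ∀ n, ((x n).1 : Circle → ℝ) z
      = Real.exp (((x n).2 : Circle → ℝ) z) := ae_all_iff.2 hx
  show (y.1 : Circle → ℝ) =ᵐ[circleLebesgue] fun z => Real.exp ((y.2 : Circle → ℝ) z)
  filter_upwards [hφ', hψ', hall] with z hz1 hz2 hz3
  have h3 := (Real.continuous_exp.tendsto _).comp hz2
  refine tendsto_nhds_unique (hz1.comp hψ.tendsto_atTop) (h3.congr fun n => ?_)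
  simp only [Function.comp_apply]
  rw [hz3]

theorem logWeights.weighted_eq (x : logWeights) :
    weighted (x.1.1 : Circle → ℝ) = weighted fun z => Real.exp ((x.1.2 : Circle → ℝ) z) :=
  weighted_congr x.2

theorem logWeights.integrable_exp (x : logWeights) :
    Integrable (fun z => Real.exp ((x.1.2 : Circle → ℝ) z)) circleLebesgue :=
  (L1.integrable_coeFn x.1.1).congr x.2

instance logWeights.isFiniteMeasure (x : logWeights) :
    IsFiniteMeasure (weighted (x.1.1 : Circle → ℝ)) :=
  isFiniteMeasure_weighted (L1.integrable_coeFn x.1.1)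

theorem logWeights.nondegenerate (x : logWeights) :
    Nondegenerate (weighted (x.1.1 : Circle → ℝ)) := by
  rw [logWeights.weighted_eq x]
  exact nondegenerate_weighted_exp (L1.integrable_coeFn x.1.2) (logWeights.integrable_exp x)

theorem logWeights.integral_weighted (x : logWeights) (f : C(Circle, ℂ)) :
    ∫ z, f z ∂(weighted (x.1.1 : Circle → ℝ))
      = ∫ z, (x.1.1 : Circle → ℝ) z • f z ∂circleLebesgue := by
  refine OPUC.integral_weighted (L1.integrable_coeFn x.1.1).aemeasurable ?_ _
  filter_upwards [x.2] with z hz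
  rw [hz]
  exact (Real.exp_pos _).le

theorem logWeights.weakTendsto (x : logWeights) :
    WeakTendsto (fun y : logWeights => weighted (y.1.1 : Circle → ℝ)) (𝓝 x)
      (weighted (x.1.1 : Circle → ℝ)) := by
  intro f
  simp only [logWeights.integral_weighted]
  have hi : ∀ w : Circle →₁[circleLebesgue] ℝ,
      Integrable (fun z => (w : Circle → ℝ) z • f z) circleLebesgue := fun w =>
    (L1.integrable_coeFn w).smul_bdd ‖f‖ f.continuous.aestronglyMeasurable
      (ae_of_all _ fun z => f.norm_coe_le_norm z)
  rw [tendsto_iff_norm_sub_tendsto_zero]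
  have hc : Tendsto (fun y : logWeights => ‖y.1.1 - x.1.1‖ * ‖f‖) (𝓝 x) (𝓝 0) := by
    have h1 : Continuous fun y : logWeights => ‖y.1.1 - x.1.1‖ * ‖f‖ := by fun_prop
    have h2 := h1.tendsto x
    simpa using h2
  refine squeeze_zero (fun _ => norm_nonneg _) (fun y => ?_) hc
  rw [← integral_sub (hi _) (hi _), L1.norm_eq_integral_norm, ← integral_mul_const]
  refine norm_integral_le_of_norm_le ((L1.integrable_coeFn (y.1.1 - x.1.1)).norm.mul_const _) ?_
  filter_upwards [Lp.coeFn_sub y.1.1 x.1.1] with z hz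
  rw [hz, Pi.sub_apply, ← sub_smul, norm_smul]
  exact mul_le_mul_of_nonneg_left (f.norm_coe_le_norm z) (norm_nonneg _)

theorem isOpen_entropyIntegral_gt (n : ℕ) (t : ℝ) :
    IsOpen {x : logWeights | t < entropyIntegral (weighted (x.1.1 : Circle → ℝ)) n} := by
  rw [isOpen_iff_mem_nhds]
  intro x hx
  exact ((logWeights.weakTendsto x).entropyIntegral (logWeights.nondegenerate x) n).eventually (lt_mem_nhds hx)

/-- Truncate u at ±k and use dominated convergence; the exponentials of the truncations are
dominated by e^u + 1. -/
theorem exists_bounded_approx {u : Circle → ℝ} (hu : Measurable u)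
    (hui : Integrable u circleLebesgue)
    (hue : Integrable (fun z => Real.exp (u z)) circleLebesgue) {η : ℝ} (hη : 0 < η) :
    ∃ u' : Circle → ℝ, Measurable u' ∧ (∃ C, ∀ z, |u' z| ≤ C) ∧
      ∫ z, |u' z - u z| ∂circleLebesgue < η ∧
      ∫ z, |Real.exp (u' z) - Real.exp (u z)| ∂circleLebesgue < η := by
  set T : ℕ → Circle → ℝ := fun k z => max (-(k : ℝ)) (min (u z) k) with hT
  have hTm : ∀ k, Measurable (T k) := fun k => measurable_const.max (hu.min measurable_const)
  have hTle : ∀ k z, |T k z| ≤ |u z| := fun k z => by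
    have hk : (0 : ℝ) ≤ k := Nat.cast_nonneg k
    have h1 := neg_abs_le (u z)
    have h2 := le_abs_self (u z)
    have h3 := abs_nonneg (u z)
    rw [abs_le]
    simp only [hT]
    refine ⟨le_max_of_le_right (le_min h1 (by linarith)), max_le (by linarith) ?_⟩
    exact (min_le_left _ _).trans h2
  have hTb : ∀ k z, |T k z| ≤ k := fun k z => by
    have hk : (0 : ℝ) ≤ k := Nat.cast_nonneg k
    rw [abs_le]
    exact ⟨le_max_left _ _, max_le (by linarith) (min_le_right _ _)⟩
  have hTe : ∀ k z, Real.exp (T k z) ≤ Real.exp (u z) + 1 := fun k z => by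
    have hk : (0 : ℝ) ≤ k := Nat.cast_nonneg k
    rcases le_total (u z) 0 with h0 | h0
    · have : T k z ≤ 0 := max_le (by linarith) ((min_le_left _ _).trans h0)
      have h1 := Real.exp_le_one_iff.2 this
      have h2 := Real.exp_pos (u z)
      linarith
    · have : T k z ≤ u z := max_le (by linarith) (min_le_left _ _)
      have h1 := Real.exp_le_exp.2 this
      linarith
  have hTlim : ∀ z, ∀ᶠ k : ℕ in atTop, T k z = u z := fun z => by
    obtain ⟨K, hK⟩ := exists_nat_ge |u z|
    filter_upwards [eventually_ge_atTop K] with k hk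
    have hk' : |u z| ≤ k := hK.trans (by exact_mod_cast hk)
    have h1 := abs_le.1 hk'
    simp only [hT]
    rw [min_eq_left h1.2, max_eq_right h1.1]
  have hlim1 : Tendsto (fun k => ∫ z, |T k z - u z| ∂circleLebesgue) atTop (𝓝 0) := by
    have := tendsto_integral_of_dominated_convergence (μ := circleLebesgue)
      (F := fun k z => |T k z - u z|) (f := fun _ => 0) (fun z => 2 * |u z|)
      (fun k => ((hTm k).sub hu).norm.aestronglyMeasurable) (hui.abs.const_mul 2)
      (fun k => ae_of_all _ fun z => by
        rw [Real.norm_eq_abs, abs_abs]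
        have h1 := abs_sub (T k z) (u z)
        have h2 := hTle k z
        linarith)
      (ae_of_all _ fun z => tendsto_const_nhds.congr' ((hTlim z).mono fun k hk => by simp [hk]))
    simpa using this
  have hlim2 : Tendsto (fun k => ∫ z, |Real.exp (T k z) - Real.exp (u z)| ∂circleLebesgue) atTop
      (𝓝 0) := by
    have := tendsto_integral_of_dominated_convergence (μ := circleLebesgue)
      (F := fun k z => |Real.exp (T k z) - Real.exp (u z)|) (f := fun _ => 0)
      (fun z => 2 * Real.exp (u z) + 1)
      (fun k => ((Real.measurable_exp.comp (hTm k)).sub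
        (Real.measurable_exp.comp hu)).norm.aestronglyMeasurable)
      ((hue.const_mul 2).add (integrable_const 1))
      (fun k => ae_of_all _ fun z => by
        rw [Real.norm_eq_abs, abs_abs, abs_le]
        have h1 := hTe k z
        have h2 := Real.exp_pos (T k z)
        have h3 := Real.exp_pos (u z)
        constructor <;> linarith)
      (ae_of_all _ fun z => tendsto_const_nhds.congr' ((hTlim z).mono fun k hk => by simp [hk]))
    simpa using this
  obtain ⟨k, hk1, hk2⟩ := ((hlim1.eventually (gt_mem_nhds hη)).and
    (hlim2.eventually (gt_mem_nhds hη))).exists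
  exact ⟨T k, hTm k, ⟨k, hTb k⟩, hk1, hk2⟩

theorem dist_toL1_eq {f : Circle → ℝ} (hf : Integrable f circleLebesgue)
    (w : Circle →₁[circleLebesgue] ℝ) :
    dist (hf.toL1 f) w = ∫ z, |f z - (w : Circle → ℝ) z| ∂circleLebesgue := by
  rw [dist_eq_norm, L1.norm_eq_integral_norm]
  refine integral_congr_ae ?_
  filter_upwards [Lp.coeFn_sub (hf.toL1 f) w, hf.coeFn_toL1] with z h1 h2
  rw [h1, Pi.sub_apply, h2, Real.norm_eq_abs]

/-- Half of the distance is spent on truncating to a bounded logarithm, half on the perturbation, in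
both L¹ coordinates. -/
theorem dense_entropyIntegral_gt {h : ℕ → ℝ} (hh : Tendsto h atTop (𝓝 0)) (N : ℕ) :
    Dense {x : logWeights | ∃ n, N ≤ n ∧
      h n * √(n : ℝ) < entropyIntegral (weighted (x.1.1 : Circle → ℝ)) n} := by
  rw [Metric.dense_iff]
  intro x r hr
  have hum : Measurable (x.1.2 : Circle → ℝ) := (Lp.stronglyMeasurable x.1.2).measurable
  have hui := L1.integrable_coeFn x.1.2
  obtain ⟨u₁, hu₁m, ⟨C₁, hC₁⟩, hu₁1, hu₁2⟩ :=
    exists_bounded_approx hum hui (logWeights.integrable_exp x) (half_pos hr)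
  obtain ⟨u₂, hu₂m, ⟨C₂, hC₂⟩, hu₂1, hu₂2, n, hn, hent⟩ :=
    exists_perturbation hh hu₁m hC₁ (half_pos hr) N
  have hi₁ := integrable_of_bounded hu₁m hC₁
  have he₁ := integrable_exp_of_bounded hu₁m hC₁
  have hi₂ := integrable_of_bounded hu₂m hC₂
  have he₂ := integrable_exp_of_bounded hu₂m hC₂
  have hmem : (he₂.toL1 _, hi₂.toL1 _) ∈ logWeights := by
    show (he₂.toL1 _ : Circle → ℝ) =ᵐ[circleLebesgue] fun z =>
      Real.exp ((hi₂.toL1 _ : Circle → ℝ) z)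
    filter_upwards [he₂.coeFn_toL1, hi₂.coeFn_toL1] with z h1 h2
    rw [h1, h2]
  have tri : ∀ f₀ f₁ f₂ : Circle → ℝ, Integrable f₀ circleLebesgue →
      Integrable f₁ circleLebesgue → Integrable f₂ circleLebesgue →
      ∫ z, |f₁ z - f₀ z| ∂circleLebesgue < r / 2 → ∫ z, |f₂ z - f₁ z| ∂circleLebesgue < r / 2 →
      ∫ z, |f₂ z - f₀ z| ∂circleLebesgue < r := by
    intro f₀ f₁ f₂ h0 h1 h2 h3 h4
    calc ∫ z, |f₂ z - f₀ z| ∂circleLebesgue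
        ≤ ∫ z, (|f₂ z - f₁ z| + |f₁ z - f₀ z|) ∂circleLebesgue :=
          integral_mono (h2.sub h0).abs ((h2.sub h1).abs.add (h1.sub h0).abs)
            fun z => abs_sub_le _ _ _
      _ = ∫ z, |f₂ z - f₁ z| ∂circleLebesgue + ∫ z, |f₁ z - f₀ z| ∂circleLebesgue :=
          integral_add (h2.sub h1).abs (h1.sub h0).abs
      _ < r := by linarith
  refine ⟨⟨_, hmem⟩, ?_, n, hn, ?_⟩
  · rw [Metric.mem_ball, Subtype.dist_eq, Prod.dist_eq, max_lt_iff]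
    refine ⟨?_, ?_⟩
    · show dist (he₂.toL1 _) x.1.1 < r
      rw [dist_toL1_eq he₂]
      have e : ∫ z, |Real.exp (u₂ z) - (x.1.1 : Circle → ℝ) z| ∂circleLebesgue
          = ∫ z, |Real.exp (u₂ z) - Real.exp ((x.1.2 : Circle → ℝ) z)| ∂circleLebesgue := by
        refine integral_congr_ae ?_
        filter_upwards [x.2] with z hz
        rw [hz]
      rw [e]
      exact tri _ _ _ (logWeights.integrable_exp x) he₁ he₂ hu₁2 hu₂2
    · show dist (hi₂.toL1 _) x.1.2 < r
      rw [dist_toL1_eq hi₂]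
      exact tri _ _ _ hui hi₁ hi₂ hu₁1 hu₂1
  · show _ < entropyIntegral (weighted (he₂.toL1 _ : Circle → ℝ)) n
    rw [weighted_congr he₂.coeFn_toL1]
    exact hent

/-- The weights whose entropy integrals are infinitely often large are generic. -/
theorem exists_weight_frequently {h : ℕ → ℝ} (hh : Tendsto h atTop (𝓝 0)) :
    ∃ x : logWeights, ∀ N, ∃ n, N ≤ n ∧
      h n * √(n : ℝ) < entropyIntegral (weighted (x.1.1 : Circle → ℝ)) n := by
  have : CompleteSpace logWeights := isClosed_logWeights.completeSpace_coe
  have hne : Nonempty logWeights := by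
    have hi : Integrable (fun _ : Circle => (0 : ℝ)) circleLebesgue := integrable_const _
    have he : Integrable (fun _ : Circle => Real.exp 0) circleLebesgue := integrable_const _
    refine ⟨⟨(he.toL1 _, hi.toL1 _), ?_⟩⟩
    show (he.toL1 _ : Circle → ℝ) =ᵐ[circleLebesgue] fun z =>
      Real.exp ((hi.toL1 _ : Circle → ℝ) z)
    filter_upwards [he.coeFn_toL1, hi.coeFn_toL1] with z h1 h2
    rw [h1, h2]
  have hd := dense_iInter_of_isOpen_nat (f := fun N : ℕ => {x : logWeights | ∃ n, N ≤ n ∧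
      h n * √(n : ℝ) < entropyIntegral (weighted (x.1.1 : Circle → ℝ)) n}) (fun N => by
    have : {x : logWeights | ∃ n, N ≤ n ∧
      h n * √(n : ℝ) < entropyIntegral (weighted (x.1.1 : Circle → ℝ)) n} =
        ⋃ n ∈ Set.Ici N, {x : logWeights |
          h n * √(n : ℝ) < entropyIntegral (weighted (x.1.1 : Circle → ℝ)) n} := by
      ext x; simp
    rw [this]
    exact isOpen_biUnion fun n _ => isOpen_entropyIntegral_gt n _) (dense_entropyIntegral_gt hh)
  obtain ⟨x, hx⟩ := hd.nonempty
  exact ⟨x, fun N => Set.mem_iInter.1 hx N⟩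

/-! ### Normalization to a probability measure -/

theorem smul_weighted_exp (u : Circle → ℝ) (t : ℝ) :
    ENNReal.ofReal (Real.exp t) • weighted (fun z => Real.exp (u z))
      = weighted fun z => Real.exp (u z + t) := by
  rw [weighted, weighted, ← withDensity_smul' _ _ ENNReal.ofReal_ne_top]
  congr 1
  ext z
  rw [Pi.smul_apply, smul_eq_mul, ← ENNReal.ofReal_mul (Real.exp_pos _).le, ← Real.exp_add,
    add_comm]

/-- The bound `o(√n)` cannot be improved. -/
theorem exists_isSzego_entropyIntegral_ge {h : ℕ → ℝ} (hh : Tendsto h atTop (𝓝 0)) :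
    ∃ σ : Measure Circle, IsProbabilityMeasure σ ∧ IsSzego σ ∧
      ∃ M : ℕ → ℕ, StrictMono M ∧ ∀ k, h (M k) * √(M k : ℝ) ≤ entropyIntegral σ (M k) := by
  have hroot : Tendsto (fun n : ℕ => √√(n : ℝ)) atTop atTop :=
    Real.tendsto_sqrt_atTop.comp (Real.tendsto_sqrt_atTop.comp tendsto_natCast_atTop_atTop)
  -- Normalizing the mass shifts every entropy integral by one constant. Enlarging h by n^{-1/4}
  -- creates a margin n^{1/4} in h(n)√n, which eventually absorbs it.
  have hh' : Tendsto (fun n : ℕ => h n + (√√(n : ℝ))⁻¹) atTop (𝓝 0) := by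
    simpa using hh.add (tendsto_inv_atTop_zero.comp hroot)
  obtain ⟨x, hx⟩ := exists_weight_frequently hh'
  set u : Circle → ℝ := (x.1.2 : Circle → ℝ) with hu
  have hui : Integrable u circleLebesgue := L1.integrable_coeFn x.1.2
  have hue := logWeights.integrable_exp x
  set ν := weighted (x.1.1 : Circle → ℝ) with hν
  have hνu : ν = weighted fun z => Real.exp (u z) := logWeights.weighted_eq x
  have hνnd : Nondegenerate ν := logWeights.nondegenerate x
  have hmass : 0 < ν.real Set.univ := by
    have h1 := hνnd 1 one_ne_zero
    simpa [energy] using h1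
  set t := -Real.log (ν.real Set.univ) with ht
  have hext : Real.exp t = (ν.real Set.univ)⁻¹ := by rw [ht, Real.exp_neg, Real.exp_log hmass]
  have hσeq := smul_weighted_exp u t
  rw [← hνu] at hσeq
  refine ⟨ENNReal.ofReal (Real.exp t) • ν, ⟨?_⟩, ?_, ?_⟩
  · rw [Measure.smul_apply, smul_eq_mul, hext, ← ENNReal.ofReal_toReal (measure_ne_top ν Set.univ),
      ← ENNReal.ofReal_mul (inv_nonneg.2 hmass.le)]
    have : (ν.real Set.univ)⁻¹ * (ν Set.univ).toReal = 1 := inv_mul_cancel₀ hmass.ne'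
    rw [this, ENNReal.ofReal_one]
  · rw [hσeq]
    refine isSzego_weighted_exp (hui.add (integrable_const t)) ?_
    simp only [Real.exp_add]
    exact hue.mul_const _
  · have hfreq : ∃ᶠ n in atTop, h n * √(n : ℝ) ≤
        entropyIntegral (ENNReal.ofReal (Real.exp t) • ν) n := by
      rw [frequently_atTop]
      intro N
      obtain ⟨K, hK⟩ := eventually_atTop.1
        ((hroot.eventually_ge_atTop (Real.log √(Real.exp t))).and (eventually_gt_atTop 0))
      obtain ⟨n, hn, hlt⟩ := hx (max N K)
      refine ⟨n, (le_max_left _ _).trans hn, ?_⟩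
      obtain ⟨hn1, hn2⟩ := hK n ((le_max_right _ _).trans hn)
      rw [hνnd.entropyIntegral_smul (Real.exp_pos t)]
      have hpos : 0 < √√(n : ℝ) := Real.sqrt_pos.2 (Real.sqrt_pos.2 (by exact_mod_cast hn2))
      have e : (√√(n : ℝ))⁻¹ * √(n : ℝ) = √√(n : ℝ) := by
        rw [inv_mul_eq_iff_eq_mul₀ hpos.ne', Real.mul_self_sqrt (Real.sqrt_nonneg _)]
      rw [add_mul, e] at hlt
      linarith
    exact extraction_of_frequently_atTop hfreq

end OPUC

theorem theorem1p1 :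
    (∀ h : ℕ → ℝ, Tendsto h atTop (𝓝 0) →
      ∃ σ : Measure Circle, IsProbabilityMeasure σ ∧ OPUC.IsSzego σ ∧
        ∃ M : ℕ → ℕ, StrictMono M ∧
          ∀ k, h (M k) * √(M k : ℝ) ≤ OPUC.entropyIntegral σ (M k)) ∧
    (∀ σ : Measure Circle, IsProbabilityMeasure σ → OPUC.IsSzego σ →
      (fun n : ℕ => OPUC.entropyIntegral σ n) =o[atTop] fun n : ℕ => √(n : ℝ)) :=
  ⟨fun _ hh => OPUC.exists_isSzego_entropyIntegral_ge hh,
    fun _ _ hs => hs.isLittleO_entropyIntegral⟩
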